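/- Let $\mathcal H$ be a separable complex Hilbert space, $p\in[1,\infty)$, $b\in(0,\infty)\cup\{\infty\}$, $\alpha\in\mathbb R$. Write $|T|=(T^*T)^{1/2}$ for $T\in\mathcal B(\mathcal H)$, and let $\mathcal B_p(\mathcal H)$ be the Schatten–von Neumann ideal with norm $\|T\|_{\mathcal B_p(\mathcal H)}=\big(\mathrm{tr}_{\mathcal H}(|T|^p)\big)^{1/p}$. Call $F:(0,b)\to\mathcal B(\mathcal H)$ admissible if it is weakly measurable (that is, $x\mapsto (u,F(x)v)_{\mathcal H}$ is measurable on $(0,b)$ for all $u,v\in\mathcal H$) and $\|F(\cdot)\|_{\mathcal B_p(\mathcal H)}\in L^p((0,b);x^\alpha dx)$. (i) If $\alpha<p-1$, then for every admissible $F$ the integrals below converge as Bochner integrals in $\mathcal B(\mathcal H)$, the two operators whose traces are taken are trace class, and $$\mathrm{tr}_{\mathcal H}\bigg(\int_0^b dx\,x^{\alpha}|F(x)|^p\bigg)\ \ge\ \bigg(\frac{|\alpha-p+1|}{p}\bigg)^p\,\mathrm{tr}_{\mathcal H}\bigg(\int_0^b dx\,x^{\alpha-p}\bigg|\int_0^x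 dx'\,F(x')\bigg|^p\bigg).$$ (ii) If $\alpha>p-1$, then the same holds for every admissible $F$ with $\int_0^x dx'\,F(x')$ replaced by $\int_x^b dx'\,F(x')$, that is, $$\mathrm{tr}_{\mathcal H}\bigg(\int_0^b dx\,x^{\alpha}|F(x)|^p\bigg)\ \ge\ \bigg(\frac{|\alpha-p+1|}{p}\bigg)^p\,\mathrm{tr}_{\mathcal H}\bigg(\int_0^b dx\,x^{\alpha-p}\bigg|\int_x^b dx'\,F(x')\bigg|^p\bigg).$$ In both cases, if $\mathcal H\neq\{0\}$, the constant $(|\alpha-p+1|/p)^p$ is best possible: for the given $\mathcal H,p,\alpha,b$, no larger constant makes the inequality hold for all admissible $F$. If $p>1$, then in both cases equality holds if and only if $F=0$ a.e. on $(0,b)$. If $p=1$, then equality holds if and only if $F=0$ a.e. on $(0,b)$ in case (i) when $b<\infty$. -/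

import Mathlib

open MeasureTheory Set
open scoped ENNReal ComplexOrder

noncomputable section

namespace OperatorHardy

/-- The interval `(0, b)` for `b ∈ (0, ∞) ∪ {∞}`. -/
def interval (b : EReal) : Set ℝ := {x | 0 < x ∧ (x : EReal) < b}

section Hilbert

variable {H : Type*} [NormedAddCommGroup H] [InnerProductSpace ℂ H] [CompleteSpace H]

variable (H) in
/-- The index set of a complete orthonormal system of `H`. -/
def onbIndex : Set H := Classical.choose (exists_hilbertBasis ℂ H)

variable (H) in
/-- A complete orthonormal system of `H`. The traces below do not depend on which one is used. -/
def onb : HilbertBasis (onbIndex H) ℂ H :=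
  Classical.choose (Classical.choose_spec (exists_hilbertBasis ℂ H))

/-- The trace `∑ₙ (eₙ, A eₙ) ∈ [0, ∞]` of a nonnegative bounded operator `A`. -/
def posTrace (A : H →L[ℂ] H) : ℝ≥0∞ :=
  ∑' i, ENNReal.ofReal (inner ℂ (onb H i) (A (onb H i))).re

/-- `|T| ^ p` where `|T| = (T* T)^{1/2}`, both by the continuous functional calculus. -/
def absPow (p : ℝ) (T : H →L[ℂ] H) : H →L[ℂ] H := (CFC.abs T) ^ p

/-- The Schatten-von Neumann norm `‖T‖_{B_p} = (tr |T|^p)^{1/p}`, with the value `∞` exactly when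
`T` does not belong to the trace ideal `B_p(H)`. -/
def schattenNorm (p : ℝ) (T : H →L[ℂ] H) : ℝ≥0∞ := (posTrace (absPow p T)) ^ (1 / p)

/-- `T ∈ B_1(H)`. -/
def IsTraceClass (T : H →L[ℂ] H) : Prop := schattenNorm 1 T < ∞

/-- The trace `∑ₙ (eₙ, T eₙ)` of a trace class operator `T` (the series is then absolutely
convergent). -/
def trace (T : H →L[ℂ] H) : ℂ := ∑' i, inner ℂ (onb H i) (T (onb H i))

/-- `F : (0, b) → B(H)` is weakly (Lebesgue) measurable, i.e., all its matrix elements are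
measurable, and `‖F(·)‖_{B_p} ∈ L^p((0, b); x^α dx)`. Values of `F` off `(0, b)` play no role. -/
structure IsAdmissible (p α : ℝ) (b : EReal) (F : ℝ → H →L[ℂ] H) : Prop where
  weaklyMeasurable : ∀ u v : H,
    AEMeasurable (fun x => (inner ℂ u (F x v) : ℂ)) (volume.restrict (interval b))
  memLp : MemLp (fun x => schattenNorm p (F x)) (ENNReal.ofReal p)
    ((volume.restrict (interval b)).withDensity fun x => ENNReal.ofReal (x ^ α))

/-- The function `x ↦ x^β |G(x)|^p`. -/
def weightedAbsPow (p β : ℝ) (G : ℝ → H →L[ℂ] H) (x : ℝ) : H →L[ℂ] H :=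
  (x ^ β : ℝ) • absPow p (G x)

/-- The function `x ↦ ∫_0^x F(x') dx'`. -/
def integralFromZero (F : ℝ → H →L[ℂ] H) (x : ℝ) : H →L[ℂ] H := ∫ t in Ioo 0 x, F t

/-- The function `x ↦ ∫_x^b F(x') dx'`. -/
def integralToEnd (b : EReal) (F : ℝ → H →L[ℂ] H) (x : ℝ) : H →L[ℂ] H :=
  ∫ t in {t : ℝ | x < t ∧ (t : EReal) < b}, F t

/-- The operator `∫_0^b x^β |G(x)|^p dx`. -/
def weightedIntegral (p β : ℝ) (b : EReal) (G : ℝ → H →L[ℂ] H) : H →L[ℂ] H :=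
  ∫ x in interval b, weightedAbsPow p β G x

end Hilbert

/-- The constant `(|α - p + 1| / p)^p`. -/
def hardyConst (p α : ℝ) : ℝ := (|α - p + 1| / p) ^ p

end OperatorHardy

end

set_option linter.unusedSectionVars false

namespace OperatorHardy

open Filter Topology

/-! ### Eigenvectors, singular values and basis independence of the trace -/

section SingularValues

universe u

variable {H : Type u} [NormedAddCommGroup H] [InnerProductSpace ℂ H] [CompleteSpace H]

/-! The proof reduces to the scalar weighted Hardy inequality for g(x) = ‖F(x)‖_p. Tonelli turns the
trace of ∫ x^β |G|^p into ∫ x^β ‖G(x)‖_p^p (`posTrace_weightedIntegral`), and Minkowski's inequality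
(`schattenNorm_integral_le`) bounds ‖∫ F‖_p by ∫ ‖F‖_p; `operator_hardy_of_scalar` combines the two.

Minkowski comes from duality: for compact T, tr |T|^p is the supremum of Σ |(f_k, T e_k)|^p over
pairs of finite orthonormal systems, and for a fixed pair this is the p-th power of the ℓ^p norm of
a linear image of T. Weak measurability suffices for Bochner integrability because operators of
finite Schatten norm are norm limits of T P_J, with P_J the projections onto spans of finitely many
vectors of a countable basis.

For the scalar inequality put γ = (p - 1 - α)/p, so that the constant is |γ|^p. Hölder against the
density t^(γ-1), on (0, x) if γ > 0 and on (x, ∞) if γ < 0, followed by Tonelli with the dual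
density x^(-γ-1), gives `hardy_of_family`. For p > 1, equality in Hölder makes g a multiple of
t^(γ-1), whose weighted p-th power is a multiple of 1/t and has infinite integral unless g = 0. For
p = 1 and b < ∞ in case (i), equality fails because the half-line inequality has a strictly positive
contribution from [b, ∞).

The constant is best possible by testing on a rank-one projection times t^(γ+ε-1), cut off below b,
as ε tends to 0. -/

lemma mem_spectrum_of_apply_eq_smul {A : H →L[ℂ] H} {v : H} {l : ℝ} (hv : A v = (l : ℂ) • v)
    (hv0 : v ≠ 0) : l ∈ spectrum ℝ A := by
  intro h
  obtain ⟨u, hu⟩ := h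
  have h0 : (u : H →L[ℂ] H) v = 0 := by
    rw [hu]
    simp [hv, Algebra.algebraMap_eq_smul_one]
  apply hv0
  have : ((↑u⁻¹ : H →L[ℂ] H) * (u : H →L[ℂ] H)) v = 0 := by
    rw [mul_apply_eq_comp, h0, map_zero]
  simpa using this

/-- The identity is clear for constants and for the identity function, and it survives sums,
products and uniform limits, so Stone–Weierstrass gives it for every continuous function on the
spectrum. -/
lemma cfc_apply_eigenvector {A : H →L[ℂ] H} (hA : IsSelfAdjoint A) {f : ℝ → ℝ}
    (hf : ContinuousOn f (spectrum ℝ A)) {v : H} {l : ℝ} (hv : A v = (l : ℂ) • v) :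
    cfc f A v = (f l : ℂ) • v := by
  rcases eq_or_ne v 0 with rfl | hv0
  · simp
  have hl := mem_spectrum_of_apply_eq_smul hv hv0
  have key : ∀ g : C(spectrum ℝ A, ℝ), cfcHom hA g v = ((g ⟨l, hl⟩ : ℝ) : ℂ) • v := by
    intro g
    have hid : cfcHom hA (.restrict (spectrum ℝ A) (.id ℝ)) v = (l : ℂ) • v := by
      rw [cfcHom_id hA, hv]
    induction g using ContinuousMap.induction_on_of_compact with
    | const r =>
      have : ContinuousMap.const (spectrum ℝ A) r = algebraMap ℝ C(spectrum ℝ A, ℝ) r := rfl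
      rw [this, AlgHomClass.commutes]
      simp [Algebra.algebraMap_eq_smul_one]
    | id => simpa using hid
    | star_id => simpa using hid
    | add f g hf hg => simp [hf, hg, add_smul]
    | mul f g hf hg =>
      rw [map_mul, mul_apply_eq_comp, hg, map_smul, hf, smul_smul, ContinuousMap.mul_apply,
        Complex.ofReal_mul, mul_comm]
    | frequently f h =>
      have hc : IsClosed {g : C(spectrum ℝ A, ℝ) |
          cfcHom hA g v = ((g ⟨l, hl⟩ : ℝ) : ℂ) • v} := by
        apply isClosed_eq
        · exact (ContinuousLinearMap.apply ℂ H v).continuous.comp (cfcHom_continuous hA)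
        · fun_prop
      exact hc.mem_of_frequently_of_tendsto h tendsto_id
  rw [cfc_apply f A hA hf, key]
  rfl

lemma rpow_apply_eigenvector {A : H →L[ℂ] H} (hA : 0 ≤ A) {r : ℝ} (hr : 0 ≤ r) {v : H} {l : ℝ}
    (hv : A v = (l : ℂ) • v) : (A ^ r) v = ((l ^ r : ℝ) : ℂ) • v := by
  rw [CFC.rpow_eq_cfc_real hA]
  exact cfc_apply_eigenvector (IsSelfAdjoint.of_nonneg hA)
    (Real.continuous_rpow_const hr).continuousOn hv

lemma absPow_eq {p : ℝ} (hp : 0 ≤ p) (T : H →L[ℂ] H) : absPow p T = (star T * T) ^ (p / 2) := by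
  rw [absPow, CFC.abs, CFC.sqrt_eq_rpow, CFC.rpow_rpow_of_exponent_nonneg _ _ _ (by norm_num) hp
    (star_mul_self_nonneg T)]
  congr 1
  ring

lemma absPow_nonneg (p : ℝ) (T : H →L[ℂ] H) : 0 ≤ absPow p T := CFC.rpow_nonneg

lemma re_inner_nonneg {A : H →L[ℂ] H} (hA : 0 ≤ A) (v : H) : 0 ≤ (inner ℂ v (A v)).re := by
  have := (ContinuousLinearMap.nonneg_iff_isPositive A).1 hA
  simpa using this.re_inner_nonneg_right v

lemma ofReal_re_inner_eq {A : H →L[ℂ] H} (hA : 0 ≤ A) (v : H) :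
    (((inner ℂ v (A v)).re : ℝ) : ℂ) = inner ℂ v (A v) := by
  have h := (ContinuousLinearMap.nonneg_iff_isPositive A).1 hA
  have := h.isSymmetric v v
  apply Complex.conj_eq_iff_re.1
  rw [inner_conj_symm]
  exact this

lemma tsum_enorm_inner_sq {ι : Type*} (b : HilbertBasis ι ℂ H) (x : H) :
    ∑' i, ‖(inner ℂ (b i) x : ℂ)‖ₑ ^ 2 = ‖x‖ₑ ^ 2 := by
  have h := b.hasSum_inner_mul_inner x x
  have h2 : HasSum (fun i => ‖(inner ℂ (b i) x : ℂ)‖ ^ 2) (‖x‖ ^ 2) := by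
    have h3 := Complex.hasSum_re h
    rw [inner_self_eq_norm_sq_to_K] at h3
    convert h3 using 1
    · ext i
      rw [← inner_conj_symm x (b i), ← Complex.normSq_eq_conj_mul_self, Complex.ofReal_re,
        Complex.normSq_eq_norm_sq]
    · norm_cast
  have h4 := ENNReal.ofReal_tsum_of_nonneg (fun i => sq_nonneg _) h2.summable
  rw [h2.tsum_eq] at h4
  simp_rw [← ofReal_norm, ← ENNReal.ofReal_pow (norm_nonneg _)]
  exact h4.symm

lemma ofReal_re_inner_eq_enorm_sqrt {A : H →L[ℂ] H} (hA : 0 ≤ A) (v : H) :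
    ENNReal.ofReal (inner ℂ v (A v)).re = ‖CFC.sqrt A v‖ₑ ^ 2 := by
  have hs : IsSelfAdjoint (CFC.sqrt A) := IsSelfAdjoint.of_nonneg (CFC.sqrt_nonneg A)
  have h : inner ℂ v (A v) = inner ℂ (CFC.sqrt A v) (CFC.sqrt A v) := by
    conv_lhs => rw [← CFC.sqrt_mul_sqrt_self A hA]
    rw [mul_apply_eq_comp, ← ContinuousLinearMap.adjoint_inner_left, hs.adjoint_eq]
  rw [h, inner_self_eq_norm_sq_to_K, ← ofReal_norm, ← ENNReal.ofReal_pow (norm_nonneg _)]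
  congr 1
  norm_cast

/-- By Parseval both sides are the double sum of |(c_j, S b_i)|², summed in the two orders. Applied
to `CFC.sqrt A`, this makes the trace independent of the basis. -/
lemma tsum_enorm_sq_adjoint {ι κ : Type*} (b : HilbertBasis ι ℂ H) (c : HilbertBasis κ ℂ H)
    (S : H →L[ℂ] H) : ∑' i, ‖S (b i)‖ₑ ^ 2 = ∑' j, ‖star S (c j)‖ₑ ^ 2 := by
  simp_rw [← tsum_enorm_inner_sq c (S _), ← tsum_enorm_inner_sq b (star S _)]
  rw [ENNReal.tsum_comm]
  refine tsum_congr fun j => tsum_congr fun i => ?_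
  rw [ContinuousLinearMap.star_eq_adjoint, ContinuousLinearMap.adjoint_inner_right,
    ← inner_conj_symm, RCLike.enorm_conj]

lemma posTrace_eq_tsum {ι : Type*} (b : HilbertBasis ι ℂ H) {A : H →L[ℂ] H} (hA : 0 ≤ A) :
    posTrace A = ∑' i, ENNReal.ofReal (inner ℂ (b i) (A (b i))).re := by
  have hs : star (CFC.sqrt A) = CFC.sqrt A := IsSelfAdjoint.of_nonneg (CFC.sqrt_nonneg A)
  simp_rw [posTrace, ofReal_re_inner_eq_enorm_sqrt hA]
  rw [tsum_enorm_sq_adjoint (onb H) b, hs]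

lemma exists_eigenbasis {A : H →L[ℂ] H} (hA : IsSelfAdjoint A) (hc : IsCompactOperator A) :
    ∃ (ι : Type u) (b : HilbertBasis ι ℂ H) (l : ι → ℂ), ∀ i, A (b i) = l i • b i := by
  have hsym : A.IsSymmetric := hA.isSymmetric
  let E : ℂ → Submodule ℂ H := fun μ => Module.End.eigenspace (A : Module.End ℂ H) μ
  have hclosed : ∀ μ, IsClosed (E μ : Set H) := fun μ => by
    have : (E μ : Set H) = {v | A v = μ • v} := by
      ext v; simp [E]
    rw [this]
    exact isClosed_eq A.continuous (continuous_const_smul μ)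
  have : ∀ μ, CompleteSpace (E μ) := fun μ => (hclosed μ).completeSpace_coe
  have hfam : OrthogonalFamily ℂ (fun μ => E μ) fun μ => (E μ).subtypeₗᵢ :=
    hsym.orthogonalFamily_eigenspaces
  choose w b hb using fun μ => exists_hilbertBasis ℂ (E μ)
  have hon := hfam.orthonormal_sigma_orthonormal (fun μ => (b μ).orthonormal)
  refine ⟨_, HilbertBasis.mkOfOrthogonalEqBot hon ?_, fun a => a.1, fun a => ?_⟩
  · rw [eq_bot_iff, ← ContinuousLinearMap.orthogonalComplement_iSup_eigenspaces_eq_bot hc hsym]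
    rw [← Submodule.iInf_orthogonal, le_iInf_iff]
    intro μ x hx
    rw [Submodule.mem_orthogonal] at hx ⊢
    intro u hu
    -- A vector orthogonal to the glued system has zero projection onto each eigenspace, and for a
    -- compact self-adjoint operator only 0 is orthogonal to all eigenspaces.
    have h1 : (b μ).repr ((E μ).orthogonalProjectionOnto x) = 0 := by
      ext i
      rw [HilbertBasis.repr_apply_apply]
      have := hx _ (Submodule.subset_span ⟨⟨μ, i⟩, rfl⟩)
      exact (Submodule.inner_orthogonalProjectionOnto_eq_of_mem_left (b μ i) x).trans this
    have h2 : (E μ).orthogonalProjectionOnto x = 0 := by simpa using h1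
    have h3 := Submodule.inner_orthogonalProjectionOnto_eq_of_mem_left (K := E μ) ⟨u, hu⟩ x
    rw [h2] at h3
    simpa using h3.symm
  · rw [HilbertBasis.coe_mkOfOrthogonalEqBot]
    exact Module.End.mem_eigenspace_iff.1 (b a.1 a.2).2

/-- A compact operator maps some complete orthonormal system to an orthogonal system; the norms of
the images are its singular values. -/
lemma exists_singular_basis {T : H →L[ℂ] H} (hT : IsCompactOperator T) :
    ∃ (ι : Type u) (b : HilbertBasis ι ℂ H),
      (∀ i j, i ≠ j → (inner ℂ (T (b i)) (T (b j)) : ℂ) = 0) ∧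
      ∀ p : ℝ, 0 < p → posTrace (absPow p T) = ∑' i, ‖T (b i)‖ₑ ^ p := by
  have hsa : IsSelfAdjoint (star T * T) := IsSelfAdjoint.star_mul_self T
  obtain ⟨ι, b, l, hl⟩ := exists_eigenbasis hsa (hT.clm_comp (star T))
  have hin : ∀ i j, (inner ℂ (T (b i)) (T (b j)) : ℂ) = l j * inner ℂ (b i) (b j) := by
    intro i j
    rw [← ContinuousLinearMap.adjoint_inner_right, ← ContinuousLinearMap.star_eq_adjoint,
      ← mul_apply_eq_comp, hl, inner_smul_right]
  have hl2 : ∀ i, l i = ((‖T (b i)‖ ^ 2 : ℝ) : ℂ) := fun i => by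
    have := hin i i
    rw [inner_self_eq_norm_sq_to_K, inner_self_eq_norm_sq_to_K, b.orthonormal.1 i] at this
    simpa using this.symm
  refine ⟨ι, b, fun i j hij => by rw [hin, b.orthonormal.2 hij, mul_zero], fun p hp => ?_⟩
  rw [posTrace_eq_tsum b (absPow_nonneg p T)]
  refine tsum_congr fun i => ?_
  rw [absPow_eq hp.le, rpow_apply_eigenvector (star_mul_self_nonneg T) (by positivity)
    ((hl i).trans (by rw [hl2])), inner_smul_right, inner_self_eq_norm_sq_to_K, b.orthonormal.1 i]
  rw [← ofReal_norm, ENNReal.ofReal_rpow_of_nonneg (norm_nonneg _) hp.le,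
    ← Real.rpow_natCast_mul (norm_nonneg _)]
  simp only [RCLike.ofReal_one, one_pow, mul_one, Complex.ofReal_re]
  congr 2
  push_cast
  ring

end SingularValues

/-! ### Weighted power means -/

section Inequalities

/-- The power mean inequality with a weight. -/
lemma lintegral_mul_rpow_le {X : Type*} [MeasurableSpace X] {μ : Measure X} {p : ℝ} (hp : 1 ≤ p)
    {k w : X → ℝ≥0∞} (hk : AEMeasurable k μ) (hw : AEMeasurable w μ) :
    (∫⁻ x, k x * w x ∂μ) ^ p ≤ (∫⁻ x, w x ∂μ) ^ (p - 1) * ∫⁻ x, k x ^ p * w x ∂μ := by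
  rcases hp.eq_or_lt with rfl | hp
  · simp
  have hp0 : 0 < p := by linarith
  have hpq := Real.HolderConjugate.conjExponent hp
  set q := p.conjExponent
  have h1 : ∀ x, k x * w x = ((fun x => k x * w x ^ (1 / p)) * fun x => w x ^ (1 / q)) x := by
    intro x
    simp only [Pi.mul_apply, one_div]
    rw [mul_assoc, ← ENNReal.rpow_add_of_nonneg _ _ hpq.inv_nonneg hpq.symm.inv_nonneg,
      hpq.inv_add_inv_eq_one, ENNReal.rpow_one]
  -- Hölder after splitting the weight as w = w^(1/p) · w^(1/q).
  have h2 := ENNReal.lintegral_mul_le_Lp_mul_Lq μ hpq (f := fun x => k x * w x ^ (1 / p))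
    (g := fun x => w x ^ (1 / q)) (by fun_prop) (by fun_prop)
  simp_rw [← h1] at h2
  have h3 : ∀ x, (k x * w x ^ (1 / p)) ^ p = k x ^ p * w x := fun x => by
    rw [ENNReal.mul_rpow_of_nonneg _ _ hp0.le, ← ENNReal.rpow_mul, one_div_mul_cancel hp0.ne',
      ENNReal.rpow_one]
  have h4 : ∀ x, (w x ^ (1 / q)) ^ q = w x := fun x => by
    rw [← ENNReal.rpow_mul, one_div_mul_cancel hpq.symm.ne_zero, ENNReal.rpow_one]
  simp_rw [h3, h4] at h2
  refine (ENNReal.rpow_le_rpow h2 hp0.le).trans_eq ?_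
  rw [ENNReal.mul_rpow_of_nonneg _ _ hp0.le, ← ENNReal.rpow_mul, ← ENNReal.rpow_mul,
    one_div_mul_cancel hp0.ne', ENNReal.rpow_one, mul_comm]
  congr 2
  rw [one_div_mul_eq_div, hpq.div_conj_eq_sub_one]

lemma tsum_mul_rpow_le {ι : Type*} {p : ℝ} (hp : 1 ≤ p) (k w : ι → ℝ≥0∞) :
    (∑' i, k i * w i) ^ p ≤ (∑' i, w i) ^ (p - 1) * ∑' i, k i ^ p * w i := by
  let _ : MeasurableSpace ι := ⊤
  have h := lintegral_mul_rpow_le (μ := Measure.count) hp (k := k) (w := w)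
    measurable_from_top.aemeasurable measurable_from_top.aemeasurable
  simpa only [lintegral_count] using h

lemma ennreal_mul_le_half_add_sq (a b : ℝ≥0∞) : a * b ≤ (a ^ 2 + b ^ 2) / 2 := by
  rw [ENNReal.le_div_iff_mul_le (by simp) (by simp)]
  induction a with
  | top => simp
  | coe a =>
    induction b with
    | top => simp
    | coe b =>
      norm_cast
      have := two_mul_le_add_sq (a : ℝ) b
      rw [← NNReal.coe_le_coe]
      push_cast
      linarith

end Inequalities

/-! ### Variational description of the Schatten norm and Minkowski's inequality -/

section Schatten

universe u

variable {H : Type u} [NormedAddCommGroup H] [InnerProductSpace ℂ H] [CompleteSpace H]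

lemma tsum_enorm_inner_sq_le {ι : Type*} {v : ι → H} (hv : Orthonormal ℂ v) (x : H) :
    ∑' i, ‖(inner ℂ (v i) x : ℂ)‖ₑ ^ 2 ≤ ‖x‖ₑ ^ 2 := by
  have h := hv.tsum_inner_products_le x
  simp_rw [← ofReal_norm, ← ENNReal.ofReal_pow (norm_nonneg _)]
  rw [← ENNReal.ofReal_tsum_of_nonneg (fun i => sq_nonneg _) (hv.inner_products_summable x)]
  exact ENNReal.ofReal_le_ofReal h

lemma orthonormal_normalize {ι : Type*} {w : ι → H}
    (h : ∀ i j, i ≠ j → (inner ℂ (w i) (w j) : ℂ) = 0) :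
    Orthonormal ℂ fun i : {i // w i ≠ 0} => ((‖w i‖ : ℂ)⁻¹ • w i) := by
  refine ⟨fun i => ?_, fun i j hij => ?_⟩
  · exact norm_smul_inv_norm (𝕜 := ℂ) i.2
  · simp only
    rw [inner_smul_left, inner_smul_right, h _ _ (fun h => hij (Subtype.ext h))]
    simp

/-- The diagonal matrix elements of a compact operator with respect to a pair of orthonormal
systems are dominated by its Schatten norm. -/
lemma sum_enorm_inner_rpow_le {κ : Type*} [Fintype κ] {e f : κ → H} (he : Orthonormal ℂ e)
    (hf : Orthonormal ℂ f) {p : ℝ} (hp : 1 ≤ p) {T : H →L[ℂ] H} (hT : IsCompactOperator T) :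
    ∑ k, ‖(inner ℂ (f k) (T (e k)) : ℂ)‖ₑ ^ p ≤ posTrace (absPow p T) := by
  obtain ⟨ι, b, horth, htr⟩ := exists_singular_basis hT
  rw [htr p (by linarith)]
  -- Normalized images; since 0⁻¹ = 0, the vector is 0 where T b_i = 0, so this is an orthonormal
  -- system up to zero vectors.
  let c : ι → H := fun i => (‖T (b i)‖ : ℂ)⁻¹ • T (b i)
  have hc1 : ∀ i, ‖c i‖ₑ ≤ 1 := fun i => by
    rw [← ofReal_norm, ← ENNReal.ofReal_one]
    refine ENNReal.ofReal_le_ofReal ?_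
    by_cases h : T (b i) = 0
    · simp [c, h]
    · exact (norm_smul_inv_norm (𝕜 := ℂ) h).le
  have hTc : ∀ i, T (b i) = (‖T (b i)‖ : ℂ) • c i := fun i => by
    by_cases h : T (b i) = 0
    · simp [c, h]
    · simp only [c]
      rw [smul_inv_smul₀]
      simpa using h
  -- The matrix element (f_k, T e_k) is Σ_i ‖T b_i‖ (b_i, e_k)(f_k, c_i), and 2ab ≤ a² + b² replaces
  -- each product by these weights. By Bessel all row and column sums of w are at most 1, so the
  -- power mean inequality in i, followed by summation over k, gives the bound.
  let w : κ → ι → ℝ≥0∞ := fun k i =>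
    (‖(inner ℂ (b i) (e k) : ℂ)‖ₑ ^ 2 + ‖(inner ℂ (c i) (f k) : ℂ)‖ₑ ^ 2) / 2
  have hhalf : ∀ a d : ℝ≥0∞, a ≤ 1 → d ≤ 1 → (a + d) / 2 ≤ 1 := fun a d ha hd => by
    refine ENNReal.div_le_of_le_mul ?_
    calc a + d ≤ 1 + 1 := add_le_add ha hd
      _ = 1 * 2 := by norm_num
  have hw1 : ∀ k, ∑' i, w k i ≤ 1 := fun k => by
    simp only [w, div_eq_mul_inv]
    rw [ENNReal.tsum_mul_right, ← div_eq_mul_inv, ENNReal.tsum_add]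
    refine hhalf _ _ ?_ ?_
    · rw [tsum_enorm_inner_sq b, ← ofReal_norm, he.1 k]
      simp
    · have h := tsum_enorm_inner_sq_le (orthonormal_normalize horth) (f k)
      rw [← ofReal_norm, hf.1 k, ENNReal.ofReal_one, one_pow] at h
      refine le_trans (le_of_eq ?_) h
      refine (tsum_subtype_eq_of_support_subset
        (f := fun i => ‖(inner ℂ (c i) (f k) : ℂ)‖ₑ ^ 2) (s := {i | T (b i) ≠ 0}) ?_).symm
      intro i hi h0
      apply hi
      simp [c, h0]
  have hw2 : ∀ i, ∑ k, w k i ≤ 1 := fun i => by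
    simp only [w, div_eq_mul_inv]
    rw [← Finset.sum_mul, ← div_eq_mul_inv, Finset.sum_add_distrib]
    have hsw : ∀ (x y : H), ‖(inner ℂ x y : ℂ)‖ₑ = ‖(inner ℂ y x : ℂ)‖ₑ := fun x y => by
      rw [← inner_conj_symm, RCLike.enorm_conj]
    refine hhalf _ _ ?_ ?_
    · have h := tsum_enorm_inner_sq_le he (b i)
      rw [tsum_fintype, ← ofReal_norm (b i), b.orthonormal.1 i, ENNReal.ofReal_one, one_pow] at h
      simpa only [hsw (b i)] using h
    · have h := tsum_enorm_inner_sq_le hf (c i)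
      rw [tsum_fintype] at h
      simp only [hsw (c i)]
      exact h.trans (pow_le_one₀ zero_le (hc1 i))
  have hle : ∀ k, ‖(inner ℂ (f k) (T (e k)) : ℂ)‖ₑ ≤ ∑' i, ‖T (b i)‖ₑ * w k i := fun k => by
    have h1 : HasSum (fun i => (inner ℂ (b i) (e k) : ℂ) * inner ℂ (f k) (T (b i)))
        (inner ℂ (f k) (T (e k))) := by
      have := ((innerSL ℂ (f k)).comp T).hasSum (b.hasSum_repr (e k))
      simpa [HilbertBasis.repr_apply_apply] using this
    rw [← h1.tsum_eq]
    refine enorm_tsum_le_tsum_enorm.trans (ENNReal.tsum_le_tsum fun i => ?_)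
    rw [enorm_mul]
    conv_lhs => rw [hTc i]
    rw [inner_smul_right, enorm_mul, mul_left_comm]
    have : ‖((‖T (b i)‖ : ℝ) : ℂ)‖ₑ = ‖T (b i)‖ₑ := by
      rw [← ofReal_norm, ← ofReal_norm]; simp
    rw [this, ← inner_conj_symm (f k), RCLike.enorm_conj]
    gcongr
    exact ennreal_mul_le_half_add_sq _ _
  have hstep : ∀ k, ‖(inner ℂ (f k) (T (e k)) : ℂ)‖ₑ ^ p ≤ ∑' i, ‖T (b i)‖ₑ ^ p * w k i :=
    fun k => by
      refine (ENNReal.rpow_le_rpow (hle k) (by linarith)).trans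
        ((tsum_mul_rpow_le hp _ _).trans ?_)
      refine mul_le_of_le_one_left zero_le ?_
      exact ENNReal.rpow_le_one (hw1 k) (by linarith)
  calc ∑ k, ‖(inner ℂ (f k) (T (e k)) : ℂ)‖ₑ ^ p ≤ ∑ k, ∑' i, ‖T (b i)‖ₑ ^ p * w k i :=
        Finset.sum_le_sum fun k _ => hstep k
    _ = ∑' i, ‖T (b i)‖ₑ ^ p * ∑ k, w k i := by
        rw [← Summable.tsum_finsetSum fun _ _ => ENNReal.summable]
        simp_rw [Finset.mul_sum]
    _ ≤ ∑' i, ‖T (b i)‖ₑ ^ p :=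
        ENNReal.tsum_le_tsum fun i => mul_le_of_le_one_right zero_le (hw2 i)

/-- Converse half of the duality: the singular basis and its normalized images are admissible test
systems, and on them the diagonal elements are the singular values themselves. -/
lemma posTrace_absPow_le_of_forall {p : ℝ} (hp : 1 ≤ p) {T : H →L[ℂ] H} (hT : IsCompactOperator T)
    {M : ℝ≥0∞} (hM : ∀ (κ : Type u) [Fintype κ] (e f : κ → H), Orthonormal ℂ e →
      Orthonormal ℂ f → ∑ k, ‖(inner ℂ (f k) (T (e k)) : ℂ)‖ₑ ^ p ≤ M) :
    posTrace (absPow p T) ≤ M := by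
  classical
  obtain ⟨ι, b, horth, htr⟩ := exists_singular_basis hT
  rw [htr p (by linarith), ENNReal.tsum_eq_iSup_sum]
  refine iSup_le fun t => ?_
  let t' : Finset {i // T (b i) ≠ 0} := t.subtype _
  have h := hM t' (fun k => b k.1.1) (fun k => (‖T (b k.1.1)‖ : ℂ)⁻¹ • T (b k.1.1))
    (b.orthonormal.comp _ (Subtype.val_injective.comp Subtype.val_injective))
    ((orthonormal_normalize horth).comp _ Subtype.val_injective)
  refine le_trans (le_of_eq ?_) h
  have hin : ∀ i : {i // T (b i) ≠ 0},
      ‖(inner ℂ ((‖T (b i)‖ : ℂ)⁻¹ • T (b i)) (T (b i)) : ℂ)‖ₑ = ‖T (b i)‖ₑ := fun i => by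
    rw [inner_smul_left, inner_self_eq_norm_sq_to_K, ← ofReal_norm, ← ofReal_norm]
    have : ‖T (b i)‖ ≠ 0 := by simpa using i.2
    congr 1
    simp
    field_simp
  simp_rw [hin]
  rw [Finset.sum_coe_sort t' fun i => ‖T (b i.1)‖ₑ ^ p, Finset.sum_subtype_eq_sum_filter
    (f := fun i => ‖T (b i)‖ₑ ^ p)]
  symm
  apply Finset.sum_filter_of_ne
  intro i _ hi h0
  apply hi
  rw [h0, enorm_zero, ENNReal.zero_rpow_of_pos (by linarith)]

/-- Minkowski's inequality for the Schatten norm of a Bochner integral. -/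
lemma schattenNorm_integral_le {X : Type*} [MeasurableSpace X] {μ : Measure X} {p : ℝ} (hp : 1 ≤ p)
    {F : X → H →L[ℂ] H} (hF : Integrable F μ) (hFc : ∀ᵐ x ∂μ, IsCompactOperator (F x))
    (hc : IsCompactOperator (∫ x, F x ∂μ : H →L[ℂ] H)) :
    schattenNorm p (∫ x, F x ∂μ) ≤ ∫⁻ x, schattenNorm p (F x) ∂μ := by
  have hp0 : 0 < p := by linarith
  rw [schattenNorm, one_div, ENNReal.rpow_inv_le_iff hp0]
  refine posTrace_absPow_le_of_forall hp hc fun κ _ e f he hf => ?_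
  have : Fact (1 ≤ ENNReal.ofReal p) := ⟨by simpa using ENNReal.ofReal_le_ofReal hp⟩
  have hpr : (ENNReal.ofReal p).toReal = p := ENNReal.toReal_ofReal hp0.le
  -- For fixed systems the diagonal elements form a continuous linear map into ℓ^p, so the triangle
  -- inequality for Bochner integrals in ℓ^p applies.
  let L : (H →L[ℂ] H) →L[ℂ] PiLp (ENNReal.ofReal p) (fun _ : κ => ℂ) :=
    (PiLp.continuousLinearEquiv (ENNReal.ofReal p) ℂ (fun _ : κ => ℂ)).symm.toContinuousLinearMap ∘L
      ContinuousLinearMap.pi fun k => (innerSL ℂ (f k)) ∘L (ContinuousLinearMap.apply ℂ H (e k))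
  have hL : ∀ A, ∑ k, ‖(inner ℂ (f k) (A (e k)) : ℂ)‖ₑ ^ p = ‖L A‖ₑ ^ p := fun A => by
    rw [← ofReal_norm, PiLp.norm_eq_sum (by rw [hpr]; exact hp0), hpr,
      ENNReal.ofReal_rpow_of_nonneg (by positivity) hp0.le, one_div,
      Real.rpow_inv_rpow (by positivity) hp0.ne', ENNReal.ofReal_sum_of_nonneg
      (fun _ _ => by positivity)]
    refine Finset.sum_congr rfl fun k _ => ?_
    rw [← ofReal_norm, ENNReal.ofReal_rpow_of_nonneg (norm_nonneg _) hp0.le]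
    rfl
  rw [hL, ← L.integral_comp_comm hF]
  refine ENNReal.rpow_le_rpow ((enorm_integral_le_lintegral_enorm _).trans
    (lintegral_mono_ae ?_)) hp0.le
  filter_upwards [hFc] with x hx
  rw [schattenNorm, one_div, ENNReal.le_rpow_inv_iff hp0, ← hL]
  exact sum_enorm_inner_rpow_le he hf hp hx

end Schatten

/-! ### Compactness and strong measurability by finite-rank approximation -/

section Approximation

universe u

variable {H : Type u} [NormedAddCommGroup H] [InnerProductSpace ℂ H] [CompleteSpace H]

lemma enorm_apply_sq_le {ι : Type*} (b : HilbertBasis ι ℂ H) (S : H →L[ℂ] H) (x : H) :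
    ‖S x‖ₑ ^ 2 ≤ (∑' i, ‖S (b i)‖ₑ ^ 2) * ‖x‖ₑ ^ 2 := by
  rw [tsum_enorm_sq_adjoint b b, ← ENNReal.tsum_mul_right, ← tsum_enorm_inner_sq b (S x)]
  refine ENNReal.tsum_le_tsum fun i => ?_
  rw [← ContinuousLinearMap.adjoint_inner_left, ← mul_pow]
  gcongr
  rw [← ofReal_norm, ← ofReal_norm, ← ofReal_norm, ← ENNReal.ofReal_mul (norm_nonneg _)]
  exact ENNReal.ofReal_le_ofReal (norm_inner_le_norm _ _)

/-- ‖A‖ = ‖√A‖², and the trace of A is the squared Hilbert–Schmidt norm of √A, which dominates the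
squared operator norm. -/
lemma enorm_le_posTrace {A : H →L[ℂ] H} (hA : 0 ≤ A) : ‖A‖ₑ ≤ posTrace A := by
  rcases eq_or_ne (posTrace A) ∞ with h | h
  · simp [h]
  have hs : star (CFC.sqrt A) = CFC.sqrt A := IsSelfAdjoint.of_nonneg (CFC.sqrt_nonneg A)
  have h1 : ‖A‖ = ‖CFC.sqrt A‖ ^ 2 := by
    conv_lhs => rw [← CFC.sqrt_mul_sqrt_self A hA]
    rw [sq, ← CStarRing.norm_star_mul_self, hs]
  have h2 : ‖CFC.sqrt A‖ ≤ √(posTrace A).toReal := by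
    refine ContinuousLinearMap.opNorm_le_bound _ (Real.sqrt_nonneg _) fun x => ?_
    have h3 := enorm_apply_sq_le (onb H) (CFC.sqrt A) x
    simp_rw [← ofReal_re_inner_eq_enorm_sqrt hA] at h3
    change _ ≤ posTrace A * _ at h3
    rw [ofReal_re_inner_eq_enorm_sqrt hA, ← ofReal_norm, ← ofReal_norm,
      ← ENNReal.ofReal_toReal h, ← ENNReal.ofReal_pow (norm_nonneg _),
      ← ENNReal.ofReal_pow (norm_nonneg _),
      ← ENNReal.ofReal_mul ENNReal.toReal_nonneg,
      ENNReal.ofReal_le_ofReal_iff (by positivity)] at h3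
    refine (sq_le_sq₀ (norm_nonneg _) (by positivity)).1 ?_
    rwa [mul_pow, Real.sq_sqrt ENNReal.toReal_nonneg]
  rw [← ofReal_norm, h1]
  refine ENNReal.ofReal_le_of_le_toReal ?_
  calc ‖CFC.sqrt A‖ ^ 2 ≤ √(posTrace A).toReal ^ 2 := by gcongr
    _ = _ := Real.sq_sqrt ENNReal.toReal_nonneg

lemma norm_absPow {p : ℝ} (hp : 0 < p) (T : H →L[ℂ] H) : ‖absPow p T‖ = ‖T‖ ^ p := by
  rw [absPow, CFC.norm_rpow _ hp (CFC.abs_nonneg T), CFC.norm_abs]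

lemma enorm_le_schattenNorm {p : ℝ} (hp : 0 < p) (T : H →L[ℂ] H) : ‖T‖ₑ ≤ schattenNorm p T := by
  rw [schattenNorm, one_div, ENNReal.le_rpow_inv_iff hp]
  refine le_trans (le_of_eq ?_) (enorm_le_posTrace (absPow_nonneg p T))
  rw [← ofReal_norm, ← ofReal_norm, ENNReal.ofReal_rpow_of_nonneg (norm_nonneg _) hp.le,
    norm_absPow hp]

variable (H) in
/-- The orthogonal projection onto the span of finitely many basis vectors. -/
noncomputable def finProj (J : Finset (onbIndex H)) : H →L[ℂ] H :=
  ∑ i ∈ J, InnerProductSpace.rankOne ℂ (onb H i) (onb H i)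

lemma finProj_apply (J : Finset (onbIndex H)) (x : H) :
    finProj H J x = ∑ i ∈ J, (inner ℂ (onb H i) x : ℂ) • onb H i := by
  simp [finProj]

open Classical in
lemma inner_sub_finProj (J : Finset (onbIndex H)) (x : H) (i : onbIndex H) :
    inner ℂ (onb H i) (x - finProj H J x) = if i ∈ J then 0 else (inner ℂ (onb H i) x : ℂ) := by
  have h : ∀ j, (inner ℂ (onb H i) (onb H j) : ℂ) = if i = j then 1 else 0 :=
    orthonormal_iff_ite.1 (onb H).orthonormal i
  rw [inner_sub_right, finProj_apply, inner_sum]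
  simp only [inner_smul_right, h, mul_ite, mul_one, mul_zero, Finset.sum_ite_eq]
  split_ifs <;> simp

open Classical in
lemma sub_finProj_basis (J : Finset (onbIndex H)) (i : onbIndex H) :
    onb H i - finProj H J (onb H i) = if i ∈ J then 0 else onb H i := by
  have h : ∀ j, (inner ℂ (onb H j) (onb H i) : ℂ) = if j = i then 1 else 0 := fun j =>
    orthonormal_iff_ite.1 (onb H).orthonormal j i
  rw [finProj_apply]
  simp only [h, ite_smul, one_smul, zero_smul, Finset.sum_ite_eq']
  split_ifs <;> simp

lemma norm_sub_finProj_le (J : Finset (onbIndex H)) (x : H) : ‖x - finProj H J x‖ ≤ ‖x‖ := by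
  classical
  have h : ‖x - finProj H J x‖ₑ ^ 2 ≤ ‖x‖ₑ ^ 2 := by
    rw [← tsum_enorm_inner_sq (onb H), ← tsum_enorm_inner_sq (onb H) x]
    refine ENNReal.tsum_le_tsum fun i => ?_
    rw [inner_sub_finProj]
    split_ifs <;> simp
  rw [← ofReal_norm, ← ofReal_norm, ← ENNReal.ofReal_pow (norm_nonneg _),
    ← ENNReal.ofReal_pow (norm_nonneg _), ENNReal.ofReal_le_ofReal_iff (by positivity)] at h
  exact (sq_le_sq₀ (norm_nonneg _) (norm_nonneg _)).1 h

/-- Quadratic forms of nonnegative operators of finite trace are small off large finite sets of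
basis vectors. -/
lemma ofReal_re_inner_sub_finProj_le {A : H →L[ℂ] H} (hA : 0 ≤ A) (J : Finset (onbIndex H))
    (x : H) :
    ENNReal.ofReal (inner ℂ (x - finProj H J x) (A (x - finProj H J x))).re ≤
      (∑' i : {i // i ∉ J}, ENNReal.ofReal (inner ℂ (onb H i) (A (onb H i))).re) * ‖x‖ₑ ^ 2 := by
  classical
  have h := enorm_apply_sq_le (onb H) (CFC.sqrt A ∘L (1 - finProj H J)) x
  simp only [ContinuousLinearMap.comp_apply, sub_apply, one_apply_eq_self] at h
  rw [ofReal_re_inner_eq_enorm_sqrt hA]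
  refine h.trans (mul_le_mul_left (le_of_eq ?_) _)
  simp_rw [ofReal_re_inner_eq_enorm_sqrt hA, sub_finProj_basis]
  symm
  refine (tsum_congr fun i => ?_).trans (tsum_subtype_eq_of_support_subset
    (f := fun i => ‖CFC.sqrt A (if i ∈ J then 0 else onb H i)‖ₑ ^ 2) (s := {i | i ∉ J}) ?_)
  · rw [if_neg i.2]
  · intro i hi h0
    apply hi
    simp [show i ∈ J by simpa using h0]

/-- Functional calculus for t ≤ ε + C t^(p/2) on the spectrum of A = T*T: for t ≥ ε the choice of C
makes C t^(p/2) ≥ ‖A‖ ≥ t. It transfers smallness of the form of |T|^p to T for every p > 0. -/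
lemma exists_star_mul_self_le {p : ℝ} (hp : 0 < p) (T : H →L[ℂ] H) {ε : ℝ} (hε : 0 < ε) :
    ∃ C : ℝ, 0 ≤ C ∧ ∀ x : H, ‖T x‖ ^ 2 ≤ ε * ‖x‖ ^ 2 + C * (inner ℂ x (absPow p T x)).re := by
  set A := star T * T with hAdef
  have hA : 0 ≤ A := star_mul_self_nonneg T
  have hAs : IsSelfAdjoint A := IsSelfAdjoint.of_nonneg hA
  refine ⟨‖A‖ / ε ^ (p / 2), by positivity, fun x => ?_⟩
  set C := ‖A‖ / ε ^ (p / 2)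
  have hle : A ≤ algebraMap ℝ (H →L[ℂ] H) ε + C • (A ^ (p / 2)) := by
    have hcont : Continuous fun t : ℝ => t ^ (p / 2) := Real.continuous_rpow_const (by positivity)
    have hcont' : Continuous fun t : ℝ => C • t ^ (p / 2) := hcont.const_smul C
    rw [CFC.rpow_eq_cfc_real hA, ← cfc_smul C _ A hcont.continuousOn,
      ← cfc_const_add ε _ A hcont'.continuousOn]
    conv_lhs => rw [← cfc_id' ℝ A]
    refine cfc_mono (fun t ht => ?_) continuousOn_id
      (continuousOn_const.add hcont'.continuousOn)
    have ht0 : 0 ≤ t := spectrum_nonneg_of_nonneg hA ht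
    have htn : t ≤ ‖A‖ := by
      rcases subsingleton_or_nontrivial H with hs | hs
      · simp [spectrum.of_subsingleton] at ht
      · exact (le_abs_self t).trans (spectrum.norm_le_norm_of_mem ht)
    simp only [smul_eq_mul]
    rcases le_total t ε with h | h
    · have : 0 ≤ C * t ^ (p / 2) := by positivity
      linarith
    · have : ‖A‖ ≤ C * t ^ (p / 2) := by
        rw [div_mul_eq_mul_div, le_div_iff₀ (by positivity)]
        gcongr
      linarith
  have h := re_inner_nonneg (sub_nonneg.2 hle) x
  have h2 : (inner ℂ x (A x)).re = ‖T x‖ ^ 2 := by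
    rw [hAdef, mul_apply_eq_comp, ContinuousLinearMap.star_eq_adjoint,
      ContinuousLinearMap.adjoint_inner_right, inner_self_eq_norm_sq_to_K]
    norm_cast
  have h3 : (inner ℂ x ((algebraMap ℝ (H →L[ℂ] H) ε) x)).re = ε * ‖x‖ ^ 2 := by
    rw [Algebra.algebraMap_eq_smul_one, smul_apply, one_apply_eq_self, inner_smul_right_eq_smul,
      inner_self_eq_norm_sq_to_K]
    simp only [Complex.real_smul, Complex.re_ofReal_mul]
    norm_cast
  rw [sub_apply, add_apply, smul_apply, inner_sub_right, inner_add_right, inner_smul_right_eq_smul,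
    Complex.sub_re, Complex.add_re, Complex.real_smul, Complex.re_ofReal_mul, h2, h3] at h
  rw [absPow_eq hp.le]
  linarith

/-- The operators that are norm limits of their restrictions to the spans of finitely many basis
vectors. -/
def IsApproximable (T : H →L[ℂ] H) : Prop :=
  Tendsto (fun J => T ∘L finProj H J) atTop (𝓝 T)

lemma isApproximable_of_schattenNorm_ne_top {p : ℝ} (hp : 0 < p) {T : H →L[ℂ] H}
    (hT : schattenNorm p T ≠ ∞) : IsApproximable T := by
  have htr : posTrace (absPow p T) ≠ ∞ := by
    intro h
    rw [schattenNorm, h, ENNReal.top_rpow_of_pos (by positivity)] at hT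
    exact hT rfl
  have htail := ENNReal.tendsto_tsum_compl_atTop_zero htr
  rw [IsApproximable, Metric.tendsto_nhds]
  intro δ hδ
  -- The two terms of the bound contribute δ²/8 each, hence ‖T - T P_J‖ ≤ δ/2. The second is
  -- controlled by the tail of the trace of |T|^p; C + 1 below avoids dividing by C = 0.
  obtain ⟨C, hC0, hC⟩ := exists_star_mul_self_le hp T (ε := δ ^ 2 / 8) (by positivity)
  have hη : 0 < ENNReal.ofReal (δ ^ 2 / 8 / (C + 1)) := by
    rw [ENNReal.ofReal_pos]; positivity
  filter_upwards [htail.eventually (gt_mem_nhds hη)] with J hJ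
  rw [dist_eq_norm, norm_sub_rev]
  have hb : ‖T - T ∘L finProj H J‖ ≤ δ / 2 := by
    refine ContinuousLinearMap.opNorm_le_bound _ (by positivity) fun x => ?_
    have h1 := hC (x - finProj H J x)
    have h2 := ofReal_re_inner_sub_finProj_le (absPow_nonneg p T) J x
    have h3 : (inner ℂ (x - finProj H J x) (absPow p T (x - finProj H J x))).re ≤
        δ ^ 2 / 8 / (C + 1) * ‖x‖ ^ 2 := by
      have h4 := h2.trans (mul_le_mul_left hJ.le _)
      rw [← ofReal_norm, ← ENNReal.ofReal_pow (norm_nonneg _),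
        ← ENNReal.ofReal_mul (by positivity), ENNReal.ofReal_le_ofReal_iff (by positivity)] at h4
      exact h4
    have h5 : C * (inner ℂ (x - finProj H J x) (absPow p T (x - finProj H J x))).re ≤
        δ ^ 2 / 8 * ‖x‖ ^ 2 := by
      calc _ ≤ C * (δ ^ 2 / 8 / (C + 1) * ‖x‖ ^ 2) := by gcongr
        _ = (C / (C + 1)) * (δ ^ 2 / 8 * ‖x‖ ^ 2) := by ring
        _ ≤ 1 * (δ ^ 2 / 8 * ‖x‖ ^ 2) := by
          gcongr
          rw [div_le_one (by positivity)]
          linarith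
        _ = _ := one_mul _
    have h6 : ‖x - finProj H J x‖ ^ 2 ≤ ‖x‖ ^ 2 := by
      gcongr
      exact norm_sub_finProj_le J x
    have h7 : (T - T ∘L finProj H J) x = T (x - finProj H J x) := by simp
    rw [h7]
    refine (sq_le_sq₀ (norm_nonneg _) (by positivity)).1 ?_
    have : δ ^ 2 / 8 * ‖x - finProj H J x‖ ^ 2 ≤ δ ^ 2 / 8 * ‖x‖ ^ 2 := by gcongr
    calc _ ≤ _ := h1
      _ ≤ δ ^ 2 / 8 * ‖x‖ ^ 2 + δ ^ 2 / 8 * ‖x‖ ^ 2 := add_le_add this h5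
      _ = (δ / 2 * ‖x‖) ^ 2 := by ring
  linarith

lemma isCompactOperator_rankOne (x y : H) :
    IsCompactOperator (InnerProductSpace.rankOne ℂ x y : H →L[ℂ] H) := by
  rw [InnerProductSpace.rankOne_def']
  exact (isCompactOperator_of_locallyCompactSpace_rng
    (ContinuousLinearMap.toSpanSingleton ℂ x)).comp_clm (innerSL ℂ y)

lemma isCompactOperator_finProj (J : Finset (onbIndex H)) :
    IsCompactOperator (finProj H J) := by
  change finProj H J ∈ compactOperator (RingHom.id ℂ) H H
  exact Submodule.sum_mem _ fun i _ => isCompactOperator_rankOne _ _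

lemma IsApproximable.isCompactOperator {T : H →L[ℂ] H} (hT : IsApproximable T) :
    IsCompactOperator T :=
  isCompactOperator_of_tendsto hT
    (Eventually.of_forall fun J => (isCompactOperator_finProj J).clm_comp T)

variable [TopologicalSpace.SeparableSpace H]

/-- Distinct basis vectors are √2 apart, so their balls of radius 1/2 are disjoint open sets in a
separable space. Countability makes `atTop` on finite subsets countably generated, as limits of
measurable functions and dominated convergence require. -/
instance : Countable (onbIndex H) := by
  have hd : (univ : Set (onbIndex H)).PairwiseDisjoint fun i => Metric.ball (onb H i) (1 / 2) := by
    intro i _ j _ hij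
    refine Metric.ball_disjoint_ball ?_
    have h2 : ‖onb H i - onb H j‖ ^ 2 = 2 := by
      rw [@norm_sub_sq ℂ, (onb H).orthonormal.2 hij, (onb H).orthonormal.1 i,
        (onb H).orthonormal.1 j]
      norm_num
    rw [dist_eq_norm]
    nlinarith [norm_nonneg (onb H i - onb H j)]
  exact countable_univ_iff.1 (hd.countable_of_isOpen (fun _ _ => Metric.isOpen_ball)
    fun i _ => Metric.nonempty_ball.2 (by norm_num))

variable {X : Type*} [MeasurableSpace X] {μ : Measure X} {F : X → H →L[ℂ] H}

/-- Composition with the projections commutes with the integral, and dominated convergence passes to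
the limit. This supplies the compactness of the integral that `schattenNorm_integral_le` assumes. -/
lemma isApproximable_integral (hF : Integrable F μ) (h : ∀ᵐ x ∂μ, IsApproximable (F x)) :
    IsApproximable (∫ x, F x ∂μ) := by
  have h1 : ∀ J, (∫ x, F x ∂μ) ∘L finProj H J = ∫ x, F x ∘L finProj H J ∂μ := fun J =>
    (((ContinuousLinearMap.compL ℂ H H H).flip (finProj H J)).integral_comp_comm hF).symm
  rw [IsApproximable]
  simp_rw [h1]
  refine tendsto_integral_filter_of_dominated_convergence (fun x => 2 * ‖F x‖) ?_ ?_ ?_ h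
  · exact Eventually.of_forall fun J =>
      ((ContinuousLinearMap.compL ℂ H H H).flip (finProj H J)).continuous.comp_aestronglyMeasurable
        hF.1
  · refine Eventually.of_forall fun J => Eventually.of_forall fun x => ?_
    have : ‖finProj H J‖ ≤ 2 := by
      refine ContinuousLinearMap.opNorm_le_bound _ (by norm_num) fun x => ?_
      have h2 := norm_sub_norm_le (finProj H J x) x
      rw [norm_sub_rev] at h2
      linarith [norm_sub_finProj_le J x]
    calc ‖F x ∘L finProj H J‖ ≤ ‖F x‖ * ‖finProj H J‖ := ContinuousLinearMap.opNorm_comp_le _ _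
      _ ≤ ‖F x‖ * 2 := by gcongr
      _ = 2 * ‖F x‖ := mul_comm _ _
  · exact hF.norm.const_mul 2

/-- A substitute for Pettis' theorem, as B(H) need not be norm separable: each vector function F(·)v
is a limit of its basis expansions, F P_J is a finite sum of rank-one operators built from such
vectors, and F is the norm limit of F P_J. -/
lemma aestronglyMeasurable_of_weaklyMeasurable
    (hF : ∀ u v : H, AEMeasurable (fun x => (inner ℂ u (F x v) : ℂ)) μ)
    (h : ∀ᵐ x ∂μ, IsApproximable (F x)) : AEStronglyMeasurable F μ := by
  have hvec : ∀ v, AEStronglyMeasurable (fun x => F x v) μ := fun v => by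
    refine aestronglyMeasurable_of_tendsto_ae (u := (atTop : Filter (Finset (onbIndex H))))
      (f := fun J x => ∑ i ∈ J, (inner ℂ (onb H i) (F x v) : ℂ) • onb H i) ?_ ?_
    · intro J
      refine Finset.aestronglyMeasurable_fun_sum _ fun i _ => ?_
      exact (hF _ v).aestronglyMeasurable.smul_const _
    · refine Eventually.of_forall fun x => ?_
      simpa [HasSum, HilbertBasis.repr_apply_apply] using (onb H).hasSum_repr (F x v)
  refine aestronglyMeasurable_of_tendsto_ae (u := (atTop : Filter (Finset (onbIndex H))))
    (f := fun J x => F x ∘L finProj H J) ?_ h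
  intro J
  simp_rw [finProj, ContinuousLinearMap.comp_finsetSum, InnerProductSpace.comp_rankOne]
  refine Finset.aestronglyMeasurable_fun_sum _ fun i _ => ?_
  have hcont : Continuous fun y : H => (InnerProductSpace.rankOne ℂ y (onb H i) : H →L[ℂ] H) :=
    ((InnerProductSpace.rankOne ℂ : H →L[ℂ] H →L⋆[ℂ] H →L[ℂ] H).flip (onb H i)).continuous
  exact hcont.comp_aestronglyMeasurable (hvec _)

lemma continuous_absPow {p : ℝ} (hp : 0 < p) : Continuous (absPow p : (H →L[ℂ] H) → H →L[ℂ] H) := by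
  have h := CFC.continuousOn_nnrpow (A := H →L[ℂ] H) ⟨p, hp.le⟩
  have h2 := h.comp_continuous (CFC.continuous_abs (A := H →L[ℂ] H)) fun T => CFC.abs_nonneg T
  refine h2.congr fun T => ?_
  exact CFC.nnrpow_eq_rpow (by exact_mod_cast hp)

lemma aemeasurable_posTrace_comp (hF : AEStronglyMeasurable F μ) :
    AEMeasurable (fun x => posTrace (F x)) μ := by
  unfold posTrace
  refine AEMeasurable.tsum fun i => ?_
  have hcont : Continuous fun T : H →L[ℂ] H => (inner ℂ (onb H i) (T (onb H i)) : ℂ).re := by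
    fun_prop
  exact (hcont.comp_aestronglyMeasurable hF).aemeasurable.ennreal_ofReal

lemma aemeasurable_schattenNorm_comp {p : ℝ} (hp : 0 < p) (hF : AEStronglyMeasurable F μ) :
    AEMeasurable (fun x => schattenNorm p (F x)) μ :=
  (aemeasurable_posTrace_comp
    ((continuous_absPow hp).comp_aestronglyMeasurable hF)).pow_const _

end Approximation

/-! ### The scalar weighted Hardy inequality and its equality case -/

section ScalarHardy

lemma ofReal_rpow_mul {x : ℝ} (hx : 0 < x) (s t : ℝ) :
    ENNReal.ofReal (x ^ s) * ENNReal.ofReal (x ^ t) = ENNReal.ofReal (x ^ (s + t)) := by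
  rw [← ENNReal.ofReal_mul (by positivity), Real.rpow_add hx]

lemma ofReal_rpow_rpow {x : ℝ} (hx : 0 < x) (s : ℝ) {t : ℝ} (ht : 0 ≤ t) :
    ENNReal.ofReal (x ^ s) ^ t = ENNReal.ofReal (x ^ (s * t)) := by
  rw [ENNReal.ofReal_rpow_of_nonneg (by positivity) ht, Real.rpow_mul hx.le]

lemma lintegral_Ioo_rpow {s : ℝ} (hs : 0 < s) {x : ℝ} (hx : 0 < x) :
    ∫⁻ t in Ioo 0 x, ENNReal.ofReal (t ^ (s - 1)) = ENNReal.ofReal (x ^ s / s) := by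
  have hint : IntervalIntegrable (fun t : ℝ => t ^ (s - 1)) volume 0 x :=
    intervalIntegral.intervalIntegrable_rpow' (by linarith)
  rw [← ofReal_integral_eq_lintegral_ofReal]
  · rw [← integral_Ioc_eq_integral_Ioo, ← intervalIntegral.integral_of_le hx.le,
      integral_rpow (Or.inl (by linarith))]
    simp [Real.zero_rpow hs.ne']
  · exact ((intervalIntegrable_iff_integrableOn_Ioo_of_le hx.le).1 hint)
  · exact (ae_restrict_mem measurableSet_Ioo).mono fun t ht => Real.rpow_nonneg ht.1.le _

lemma lintegral_Ioi_rpow {s : ℝ} (hs : 0 < s) {x : ℝ} (hx : 0 < x) :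
    ∫⁻ t in Ioi x, ENNReal.ofReal (t ^ (-s - 1)) = ENNReal.ofReal (x ^ (-s) / s) := by
  rw [← ofReal_integral_eq_lintegral_ofReal (integrableOn_Ioi_rpow_of_lt (by linarith) hx),
    integral_Ioi_rpow_of_lt (by linarith) hx]
  · congr 1
    rw [sub_add_cancel, neg_div_neg_eq]
  · exact (ae_restrict_mem measurableSet_Ioi).mono fun t ht =>
      Real.rpow_nonneg (hx.le.trans (le_of_lt ht)) _

lemma lintegral_ofReal_inv_eq_top {s : Set ℝ} (hs : MeasurableSet s) (h0 : s ⊆ Ioi 0)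
    (h : ¬ IntegrableOn (fun t : ℝ => t⁻¹) s) : ∫⁻ t in s, ENNReal.ofReal (t ^ (-1 : ℝ)) = ∞ := by
  by_contra hne
  apply h
  refine ⟨by fun_prop, ?_⟩
  rw [hasFiniteIntegral_iff_enorm, lt_top_iff_ne_top]
  convert hne using 1
  refine setLIntegral_congr_fun hs fun t ht => ?_
  have : 0 < t := h0 ht
  rw [Real.rpow_neg_one, Real.enorm_of_nonneg (by positivity)]

/-- The case of equality in the power mean inequality. -/
lemma exists_ae_eq_const_of_lintegral_rpow_eq {X : Type*} [MeasurableSpace X] {m : Measure X}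
    [IsFiniteMeasure m] {p : ℝ} (hp : 1 < p) {k : X → ℝ≥0∞} (hk : AEMeasurable k m)
    (hfin : ∫⁻ x, k x ^ p ∂m ≠ ∞)
    (h : m univ ^ (p - 1) * ∫⁻ x, k x ^ p ∂m ≤ (∫⁻ x, k x ∂m) ^ p) :
    ∃ c, ∀ᵐ x ∂m, k x = c := by
  have hp0 : 0 < p := by linarith
  rcases eq_or_ne m 0 with rfl | hm
  · exact ⟨0, by simp⟩
  have hmu : m univ ≠ 0 := by simpa using hm
  have hmt : m univ ≠ ∞ := measure_ne_top _ _
  have hk1 : ∫⁻ x, k x ∂m ≠ ∞ := by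
    have h1 := lintegral_mul_rpow_le (μ := m) hp.le hk (w := fun _ => 1) aemeasurable_const
    simp only [mul_one, lintegral_one] at h1
    intro h2
    rw [h2, ENNReal.top_rpow_of_pos hp0, top_le_iff] at h1
    exact ENNReal.mul_ne_top (ENNReal.rpow_ne_top_of_nonneg (by linarith) hmt) hfin h1
  have hkt : ∀ᵐ x ∂m, k x < ∞ := ae_lt_top' hk hk1
  have hkp : AEMeasurable (fun x => k x ^ p) m := hk.pow_const _
  have hpt : ∀ᵐ x ∂m, k x ^ p < ∞ := ae_lt_top' hkp hfin
  have hcomp : ((fun t : ℝ => t ^ p) ∘ fun x => (k x).toReal) = fun x => (k x ^ p).toReal := by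
    ext x
    simp [ENNReal.toReal_rpow]
  have hi1 : Integrable (fun x => (k x).toReal) m := integrable_toReal_of_lintegral_ne_top hk hk1
  have hi2 : Integrable (fun x => (k x ^ p).toReal) m :=
    integrable_toReal_of_lintegral_ne_top hkp hfin
  -- Strict Jensen for t^p: a nonconstant k would make the inequality strict, against the hypothesis
  -- once multiplied by m(X)^p.
  rcases (strictConvexOn_rpow hp).ae_eq_const_or_map_average_lt (μ := m)
    (f := fun x => (k x).toReal) (Real.continuous_rpow_const hp0.le).continuousOn isClosed_Ici
    (Eventually.of_forall fun x => ENNReal.toReal_nonneg) hi1 (by rw [hcomp]; exact hi2) with h1 | h1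
  · refine ⟨ENNReal.ofReal (⨍ x, (k x).toReal ∂m), ?_⟩
    filter_upwards [h1, hkt] with x hx hx'
    rw [← ENNReal.ofReal_toReal hx'.ne, hx]
    rfl
  · exfalso
    have e : ∀ x, (k x).toReal ^ p = (k x ^ p).toReal := fun x => congrFun hcomp x
    simp_rw [e] at h1
    rw [average_eq, average_eq, integral_toReal hk hkt, integral_toReal hkp hpt] at h1
    have hr := ENNReal.toReal_mono (ENNReal.rpow_ne_top_of_nonneg hp0.le hk1) h
    rw [ENNReal.toReal_mul, ← ENNReal.toReal_rpow, ← ENNReal.toReal_rpow] at hr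
    have hM : 0 < m.real univ := ENNReal.toReal_pos hmu hmt
    change m.real univ ^ (p - 1) * _ ≤ _ at hr
    simp only [smul_eq_mul] at h1
    rw [Real.mul_rpow (by positivity) ENNReal.toReal_nonneg, Real.inv_rpow hM.le,
      ← div_eq_inv_mul, div_lt_iff₀ (by positivity)] at h1
    have : (m.real univ)⁻¹ * (∫⁻ x, k x ^ p ∂m).toReal * m.real univ ^ p =
        m.real univ ^ (p - 1) * (∫⁻ x, k x ^ p ∂m).toReal := by
      rw [Real.rpow_sub_one hM.ne']
      ring
    linarith

variable {p α γ : ℝ} {S : ℝ → Set ℝ} {g : ℝ → ℝ≥0∞}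

/-- Lebesgue measure on the half-line `(0, ∞)`. -/
noncomputable abbrev halfLine : Measure ℝ := volume.restrict (Ioi 0)

/-- Factorization g = k · t^(γ-1) with k = g t^(1-γ), which prepares Hölder against the density
t^(γ-1). -/
lemma hardy_pointwise_density (hα : α = p - 1 - p * γ) (hp : 1 ≤ p) {t : ℝ} (ht : 0 < t)
    (y : ℝ≥0∞) : y * ENNReal.ofReal (t ^ (1 - γ)) * ENNReal.ofReal (t ^ (γ - 1)) = y ∧
      (y * ENNReal.ofReal (t ^ (1 - γ))) ^ p * ENNReal.ofReal (t ^ (γ - 1)) =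
        y ^ p * ENNReal.ofReal (t ^ (α + γ)) := by
  constructor
  · rw [mul_assoc, ofReal_rpow_mul ht]
    simp
  · rw [ENNReal.mul_rpow_of_nonneg _ _ (by linarith), ofReal_rpow_rpow ht _ (by linarith),
      mul_assoc, ofReal_rpow_mul ht, hα]
    congr 3
    ring

lemma hardy_holder (hα : α = p - 1 - p * γ) (hp : 1 ≤ p) (hg : Measurable g) (x : ℝ) :
    (∫⁻ t in S x, g t ∂halfLine) ^ p ≤ (∫⁻ t in S x, ENNReal.ofReal (t ^ (γ - 1)) ∂halfLine) ^ (p - 1) *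
      ∫⁻ t in S x, g t ^ p * ENNReal.ofReal (t ^ (α + γ)) ∂halfLine := by
  have hpos : ∀ᵐ t ∂(halfLine.restrict (S x)), 0 < t := ae_restrict_of_ae (ae_restrict_mem measurableSet_Ioi)
  have h := lintegral_mul_rpow_le (μ := halfLine.restrict (S x)) hp
    (k := fun t => g t * ENNReal.ofReal (t ^ (1 - γ))) (w := fun t => ENNReal.ofReal (t ^ (γ - 1)))
    (by fun_prop) (by fun_prop)
  rw [lintegral_congr_ae (hpos.mono fun t ht => (hardy_pointwise_density hα hp ht (g t)).1),
    lintegral_congr_ae (hpos.mono fun t ht => (hardy_pointwise_density hα hp ht (g t)).2)] at h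
  exact h

lemma hardy_pointwise (hα : α = p - 1 - p * γ) (hp : 1 ≤ p) (hγ : γ ≠ 0) (hg : Measurable g)
    (h1 : ∀ x, 0 < x → ∫⁻ t in S x, ENNReal.ofReal (t ^ (γ - 1)) ∂halfLine =
      ENNReal.ofReal (x ^ γ / |γ|)) {x : ℝ} (hx : 0 < x) :
    ENNReal.ofReal (x ^ (α - p)) * (∫⁻ t in S x, g t ∂halfLine) ^ p ≤
      ENNReal.ofReal (|γ| ^ (1 - p)) * (ENNReal.ofReal (x ^ (-γ - 1)) *
        ∫⁻ t in S x, g t ^ p * ENNReal.ofReal (t ^ (α + γ)) ∂halfLine) := by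
  have hγ' : 0 < |γ| := abs_pos.2 hγ
  refine (mul_le_mul_right (hardy_holder hα hp hg x) _).trans_eq ?_
  rw [h1 x hx, ← mul_assoc, ← mul_assoc]
  congr 1
  rw [ENNReal.ofReal_rpow_of_nonneg (by positivity) (by linarith),
    ← ENNReal.ofReal_mul (by positivity), ← ENNReal.ofReal_mul (by positivity)]
  congr 1
  rw [Real.div_rpow (by positivity) (by positivity), ← Real.rpow_mul hx.le,
    div_eq_mul_inv, ← Real.rpow_neg hγ'.le, ← mul_assoc, ← Real.rpow_add hx, neg_sub, mul_comm, hα]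
  congr 2
  ring

/-- Tonelli: integrating x^(-γ-1) over {x | t ∈ S x} yields t^(-γ)/|γ|, which cancels the factor
t^γ. No loss occurs here, so any loss in the half-line inequality comes from Hölder. -/
lemma hardy_lintegral_majorant (hγ : γ ≠ 0) (hg : Measurable g)
    (hS : MeasurableSet {q : ℝ × ℝ | q.2 ∈ S q.1})
    (h2 : ∀ t, 0 < t → ∫⁻ x in {x | t ∈ S x}, ENNReal.ofReal (x ^ (-γ - 1)) ∂halfLine =
      ENNReal.ofReal (t ^ (-γ) / |γ|)) :
    ∫⁻ x, ENNReal.ofReal (|γ| ^ (1 - p)) * (ENNReal.ofReal (x ^ (-γ - 1)) *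
        ∫⁻ t in S x, g t ^ p * ENNReal.ofReal (t ^ (α + γ)) ∂halfLine) ∂halfLine =
      ENNReal.ofReal (|γ| ^ (-p)) * ∫⁻ t, ENNReal.ofReal (t ^ α) * g t ^ p ∂halfLine := by
  have hγ' : 0 < |γ| := abs_pos.2 hγ
  have hSx : ∀ x, MeasurableSet (S x) := fun x => (measurable_prodMk_left (x := x)) hS
  have hSt : ∀ t, MeasurableSet {x | t ∈ S x} := fun t => (measurable_prodMk_right (y := t)) hS
  rw [lintegral_const_mul' _ _ ENNReal.ofReal_ne_top]
  have e1 : ∀ x, ENNReal.ofReal (x ^ (-γ - 1)) *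
        ∫⁻ t in S x, g t ^ p * ENNReal.ofReal (t ^ (α + γ)) ∂halfLine =
      ∫⁻ t, {q : ℝ × ℝ | q.2 ∈ S q.1}.indicator (fun q => ENNReal.ofReal (q.1 ^ (-γ - 1)) *
        (g q.2 ^ p * ENNReal.ofReal (q.2 ^ (α + γ)))) (x, t) ∂halfLine := fun x => by
    rw [← lintegral_const_mul' _ _ ENNReal.ofReal_ne_top, ← lintegral_indicator (hSx x)]
    rfl
  simp_rw [e1]
  have hmeas : Measurable ({q : ℝ × ℝ | q.2 ∈ S q.1}.indicator fun q =>
      ENNReal.ofReal (q.1 ^ (-γ - 1)) * (g q.2 ^ p * ENNReal.ofReal (q.2 ^ (α + γ)))) :=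
    Measurable.indicator (by fun_prop) hS
  rw [lintegral_lintegral_swap (f := fun x t => {q : ℝ × ℝ | q.2 ∈ S q.1}.indicator
    (fun q => ENNReal.ofReal (q.1 ^ (-γ - 1)) * (g q.2 ^ p * ENNReal.ofReal (q.2 ^ (α + γ)))) (x, t))
    hmeas.aemeasurable]
  have e2 : ∀ t, 0 < t → ∫⁻ x, {q : ℝ × ℝ | q.2 ∈ S q.1}.indicator
      (fun q => ENNReal.ofReal (q.1 ^ (-γ - 1)) *
        (g q.2 ^ p * ENNReal.ofReal (q.2 ^ (α + γ)))) (x, t) ∂halfLine =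
      ENNReal.ofReal |γ|⁻¹ * (ENNReal.ofReal (t ^ α) * g t ^ p) := fun t ht => by
    have : ∀ x, {q : ℝ × ℝ | q.2 ∈ S q.1}.indicator
        (fun q => ENNReal.ofReal (q.1 ^ (-γ - 1)) *
          (g q.2 ^ p * ENNReal.ofReal (q.2 ^ (α + γ)))) (x, t) =
        {x | t ∈ S x}.indicator (fun x => ENNReal.ofReal (x ^ (-γ - 1)) *
          (g t ^ p * ENNReal.ofReal (t ^ (α + γ)))) x := fun x => rfl
    simp_rw [this]
    rw [lintegral_indicator (hSt t), lintegral_mul_const _ (by fun_prop), h2 t ht,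
      div_eq_mul_inv, ENNReal.ofReal_mul (by positivity)]
    calc _ = ENNReal.ofReal |γ|⁻¹ * ((ENNReal.ofReal (t ^ (-γ)) * ENNReal.ofReal (t ^ (α + γ))) *
          g t ^ p) := by ring
      _ = _ := by rw [ofReal_rpow_mul ht]; congr 4; ring
  rw [lintegral_congr_ae ((ae_restrict_mem measurableSet_Ioi).mono fun t ht => e2 t ht),
    lintegral_const_mul' _ _ ENNReal.ofReal_ne_top, ← mul_assoc,
    ← ENNReal.ofReal_mul (by positivity)]
  congr 2
  rw [← Real.rpow_neg_one, ← Real.rpow_add hγ']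
  congr 1
  ring

/-- Hardy's inequality in terms of a family of sets with suitable weighted measures. -/
lemma hardy_of_family (hα : α = p - 1 - p * γ) (hp : 1 ≤ p) (hγ : γ ≠ 0) (hg : Measurable g)
    (hS : MeasurableSet {q : ℝ × ℝ | q.2 ∈ S q.1})
    (h1 : ∀ x, 0 < x → ∫⁻ t in S x, ENNReal.ofReal (t ^ (γ - 1)) ∂halfLine =
      ENNReal.ofReal (x ^ γ / |γ|))
    (h2 : ∀ t, 0 < t → ∫⁻ x in {x | t ∈ S x}, ENNReal.ofReal (x ^ (-γ - 1)) ∂halfLine =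
      ENNReal.ofReal (t ^ (-γ) / |γ|)) :
    ENNReal.ofReal (|γ| ^ p) * ∫⁻ x, ENNReal.ofReal (x ^ (α - p)) * (∫⁻ t in S x, g t ∂halfLine) ^ p ∂halfLine ≤
      ∫⁻ t, ENNReal.ofReal (t ^ α) * g t ^ p ∂halfLine := by
  have hγ' : 0 < |γ| := abs_pos.2 hγ
  have h := lintegral_mono_ae (μ := halfLine) ((ae_restrict_mem measurableSet_Ioi).mono fun x hx =>
    hardy_pointwise (S := S) hα hp hγ hg h1 (mem_Ioi.1 hx))
  rw [hardy_lintegral_majorant hγ hg hS h2] at h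
  refine (mul_le_mul_right h _).trans_eq ?_
  rw [← mul_assoc, ← ENNReal.ofReal_mul (by positivity), ← Real.rpow_add hγ']
  simp

lemma hardy_of_family_eq (hα : α = p - 1 - p * γ) (hp : 1 < p) (hγ : γ ≠ 0) (hg : Measurable g)
    (hS : MeasurableSet {q : ℝ × ℝ | q.2 ∈ S q.1})
    (h1 : ∀ x, 0 < x → ∫⁻ t in S x, ENNReal.ofReal (t ^ (γ - 1)) ∂halfLine =
      ENNReal.ofReal (x ^ γ / |γ|))
    (h2 : ∀ t, 0 < t → ∫⁻ x in {x | t ∈ S x}, ENNReal.ofReal (x ^ (-γ - 1)) ∂halfLine =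
      ENNReal.ofReal (t ^ (-γ) / |γ|))
    (h3 : ∀ x, 0 < x → ∫⁻ t in S x, ENNReal.ofReal (t ^ (-1 : ℝ)) ∂halfLine = ∞)
    (hfin : ∫⁻ t, ENNReal.ofReal (t ^ α) * g t ^ p ∂halfLine ≠ ∞)
    (heq : ∫⁻ t, ENNReal.ofReal (t ^ α) * g t ^ p ∂halfLine ≤ ENNReal.ofReal (|γ| ^ p) *
      ∫⁻ x, ENNReal.ofReal (x ^ (α - p)) * (∫⁻ t in S x, g t ∂halfLine) ^ p ∂halfLine) :
    ∀ᵐ t ∂halfLine, g t = 0 := by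
  have hp0 : 0 < p := by linarith
  have hγ' : 0 < |γ| := abs_pos.2 hγ
  have hSx : ∀ x, MeasurableSet (S x) := fun x => (measurable_prodMk_left (x := x)) hS
  have hmaj := hardy_lintegral_majorant (p := p) (α := α) hγ hg hS h2
  have hmeas : Measurable fun x => ENNReal.ofReal (|γ| ^ (1 - p)) *
      (ENNReal.ofReal (x ^ (-γ - 1)) *
        ∫⁻ t in S x, g t ^ p * ENNReal.ofReal (t ^ (α + γ)) ∂halfLine) := by
    have : Measurable fun x => ∫⁻ t in S x, g t ^ p * ENNReal.ofReal (t ^ (α + γ)) ∂halfLine := by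
      have e : ∀ x, ∫⁻ t in S x, g t ^ p * ENNReal.ofReal (t ^ (α + γ)) ∂halfLine =
          ∫⁻ t, {q : ℝ × ℝ | q.2 ∈ S q.1}.indicator
            (fun q => g q.2 ^ p * ENNReal.ofReal (q.2 ^ (α + γ))) (x, t) ∂halfLine := fun x => by
        rw [← lintegral_indicator (hSx x)]
        rfl
      simp_rw [e]
      exact (Measurable.indicator (by fun_prop) hS).lintegral_prod_right'
    fun_prop
  have hmajfin : ∫⁻ x, ENNReal.ofReal (|γ| ^ (1 - p)) * (ENNReal.ofReal (x ^ (-γ - 1)) *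
        ∫⁻ t in S x, g t ^ p * ENNReal.ofReal (t ^ (α + γ)) ∂halfLine) ∂halfLine ≠ ∞ := by
    rw [hmaj]
    exact ENNReal.mul_ne_top ENNReal.ofReal_ne_top hfin
  have hle : ∀ᵐ x ∂halfLine, ENNReal.ofReal (x ^ (α - p)) * (∫⁻ t in S x, g t ∂halfLine) ^ p ≤
      ENNReal.ofReal (|γ| ^ (1 - p)) * (ENNReal.ofReal (x ^ (-γ - 1)) *
        ∫⁻ t in S x, g t ^ p * ENNReal.ofReal (t ^ (α + γ)) ∂halfLine) :=
    (ae_restrict_mem measurableSet_Ioi).mono fun x hx =>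
      hardy_pointwise hα hp.le hγ hg h1 (mem_Ioi.1 hx)
  -- Equality of finite integrals upgrades the pointwise Hölder bound to equality for almost every
  -- x.
  have hae := ae_eq_of_ae_le_of_lintegral_le hle
    (ne_top_of_le_ne_top hmajfin (lintegral_mono_ae hle)) hmeas.aemeasurable (by
      rw [hmaj]
      refine (mul_le_mul_right heq _).trans_eq ?_
      rw [← mul_assoc, ← ENNReal.ofReal_mul (by positivity), ← Real.rpow_add hγ']
      simp)
  have hzero : ∀ᵐ x ∂halfLine, ENNReal.ofReal (x ^ (α - p)) * (∫⁻ t in S x, g t ∂halfLine) ^ p = 0 := by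
    filter_upwards [hae, ae_lt_top hmeas hmajfin, ae_restrict_mem measurableSet_Ioi]
      with x hx hxfin hx0
    replace hx0 : 0 < x := hx0
    have hpos : ∀ᵐ t ∂(halfLine.restrict (S x)), 0 < t :=
      ae_restrict_of_ae (ae_restrict_mem measurableSet_Ioi)
    let w : ℝ → ℝ≥0∞ := fun t => ENNReal.ofReal (t ^ (γ - 1))
    have hw : Measurable w := by fun_prop
    let m : Measure ℝ := (halfLine.restrict (S x)).withDensity w
    have hmu : m univ = ENNReal.ofReal (x ^ γ / |γ|) := by
      rw [withDensity_apply _ MeasurableSet.univ, Measure.restrict_univ, h1 x hx0]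
    have : IsFiniteMeasure m := ⟨by rw [hmu]; exact ENNReal.ofReal_lt_top⟩
    let k : ℝ → ℝ≥0∞ := fun t => g t * ENNReal.ofReal (t ^ (1 - γ))
    have hk : Measurable k := by fun_prop
    have i1 : ∫⁻ t, k t ∂m = ∫⁻ t in S x, g t ∂halfLine := by
      rw [lintegral_withDensity_eq_lintegral_mul _ hw hk]
      refine lintegral_congr_ae (hpos.mono fun t ht => ?_)
      simp only [Pi.mul_apply, mul_comm (w t)]
      exact (hardy_pointwise_density hα hp.le ht (g t)).1
    have i2 : ∫⁻ t, k t ^ p ∂m = ∫⁻ t in S x, g t ^ p * ENNReal.ofReal (t ^ (α + γ)) ∂halfLine := by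
      rw [lintegral_withDensity_eq_lintegral_mul _ hw (by fun_prop)]
      refine lintegral_congr_ae (hpos.mono fun t ht => ?_)
      simp only [Pi.mul_apply, mul_comm (w t)]
      exact (hardy_pointwise_density hα hp.le ht (g t)).2
    have hI : ∫⁻ t, k t ^ p ∂m ≠ ∞ := by
      rw [i2]
      intro h
      rw [h, ENNReal.mul_top (by rw [Ne, ENNReal.ofReal_eq_zero, not_le]; positivity),
        ENNReal.mul_top (by rw [Ne, ENNReal.ofReal_eq_zero, not_le]; positivity)] at hxfin
      exact hxfin.ne rfl
    have hpm : m univ ^ (p - 1) * ∫⁻ t, k t ^ p ∂m ≤ (∫⁻ t, k t ∂m) ^ p := by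
      rw [i1, i2, hmu]
      have hc0 : ENNReal.ofReal (x ^ (α - p)) ≠ 0 := by
        rw [Ne, ENNReal.ofReal_eq_zero, not_le]; positivity
      rw [← ENNReal.mul_le_mul_iff_right hc0 ENNReal.ofReal_ne_top, hx, ← mul_assoc, ← mul_assoc]
      refine le_of_eq ?_
      congr 1
      rw [ENNReal.ofReal_rpow_of_nonneg (by positivity) (by linarith),
        ← ENNReal.ofReal_mul (by positivity), ← ENNReal.ofReal_mul (by positivity)]
      congr 1
      rw [Real.div_rpow (by positivity) (by positivity), ← Real.rpow_mul hx0.le,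
        div_eq_mul_inv, ← Real.rpow_neg hγ'.le, ← mul_assoc, ← Real.rpow_add hx0, neg_sub,
        mul_comm, hα]
      congr 2
      ring
    obtain ⟨c, hc⟩ := exists_ae_eq_const_of_lintegral_rpow_eq hp hk.aemeasurable hI hpm
    have hc' : ∀ᵐ t ∂(halfLine.restrict (S x)), k t = c := by
      rw [ae_withDensity_iff hw] at hc
      filter_upwards [hc, hpos] with t ht ht0
      refine ht ?_
      simp only [w]
      rw [Ne, ENNReal.ofReal_eq_zero, not_le]
      positivity
    -- If g = c t^(γ-1) on S x, then t^α g^p = c^p / t there, whose integral diverges unless c = 0.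
    have hc0 : c = 0 := by
      by_contra hc0
      apply hfin
      rw [← top_le_iff]
      calc ∞ = c ^ p * ∫⁻ t in S x, ENNReal.ofReal (t ^ (-1 : ℝ)) ∂halfLine := by
            rw [h3 x hx0, ENNReal.mul_top]
            simp [hc0, hp0.le]
        _ = ∫⁻ t in S x, c ^ p * ENNReal.ofReal (t ^ (-1 : ℝ)) ∂halfLine :=
            (lintegral_const_mul _ (by fun_prop)).symm
        _ = ∫⁻ t in S x, ENNReal.ofReal (t ^ α) * g t ^ p ∂halfLine := by
            refine lintegral_congr_ae ?_
            filter_upwards [hc', hpos] with t ht ht0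
            simp only [k] at ht
            rw [← ht, ENNReal.mul_rpow_of_nonneg _ _ hp0.le, ofReal_rpow_rpow ht0 _ hp0.le,
              mul_assoc, ofReal_rpow_mul ht0, mul_comm, hα]
            congr 3
            ring
        _ ≤ ∫⁻ t, ENNReal.ofReal (t ^ α) * g t ^ p ∂halfLine := setLIntegral_le_lintegral _ _
    have : ∫⁻ t in S x, g t ∂halfLine = 0 := by
      rw [lintegral_eq_zero_iff hg]
      filter_upwards [hc', hpos] with t ht ht0
      have h5 := (hardy_pointwise_density (α := α) hα hp.le ht0 (g t)).1
      simp only [k] at ht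
      rw [ht, hc0, zero_mul] at h5
      exact h5.symm
    rw [this, ENNReal.zero_rpow_of_pos hp0, mul_zero]
  -- The Hardy side vanishes, so the assumed reverse inequality makes the integral of t^α g^p zero.
  rw [lintegral_congr_ae hzero, lintegral_zero, mul_zero, nonpos_iff_eq_zero,
    lintegral_eq_zero_iff (by fun_prop)] at heq
  filter_upwards [heq, ae_restrict_mem measurableSet_Ioi] with t ht ht0
  replace ht0 : 0 < t := ht0
  have hc0 : ENNReal.ofReal (t ^ α) ≠ 0 := by
    rw [Ne, ENNReal.ofReal_eq_zero, not_le]; positivity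
  simpa [hc0, hp0, hp0.not_gt] using ht

lemma measurableSet_interval (b : EReal) : MeasurableSet (interval b) :=
  measurableSet_Ioi.inter (measurable_coe_real_ereal measurableSet_Iio)

/-- Extension by zero reduces every b to the half-line. Vanishing off the interval is recorded for
the equality case p = 1, b < ∞. -/
lemma exists_halfLine_extension (b : EReal) {J : ℝ → Set ℝ} (hS : ∀ x, MeasurableSet (S x))
    (hJ : ∀ x ∈ interval b, J x = S x ∩ interval b) (hp : 0 < p)
    (hg : AEMeasurable g (volume.restrict (interval b))) :
    ∃ g' : ℝ → ℝ≥0∞, Measurable g' ∧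
      ∫⁻ t, ENNReal.ofReal (t ^ α) * g' t ^ p ∂halfLine =
        ∫⁻ t in interval b, ENNReal.ofReal (t ^ α) * g t ^ p ∧
      (∀ x ∈ interval b, ∫⁻ t in S x, g' t ∂halfLine = ∫⁻ t in J x, g t) ∧
      ((∀ᵐ t ∂halfLine, g' t = 0) → ∀ᵐ t ∂volume.restrict (interval b), g t = 0) ∧
      ∀ t ∉ interval b, g' t = 0 := by
  have hI := measurableSet_interval b
  have hsub : interval b ⊆ Ioi 0 := fun x hx => hx.1
  have hmk := hg.ae_eq_mk
  refine ⟨(interval b).indicator (hg.mk g), hg.measurable_mk.indicator hI, ?_, fun x hx => ?_,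
    fun h => ?_, fun t ht => indicator_of_notMem ht _⟩
  · have e : ∀ t, ENNReal.ofReal (t ^ α) * (interval b).indicator (hg.mk g) t ^ p =
        (interval b).indicator (fun t => ENNReal.ofReal (t ^ α) * hg.mk g t ^ p) t := fun t => by
      by_cases ht : t ∈ interval b
      · rw [indicator_of_mem ht, indicator_of_mem ht]
      · rw [indicator_of_notMem ht, indicator_of_notMem ht, ENNReal.zero_rpow_of_pos hp, mul_zero]
    simp_rw [e]
    rw [lintegral_indicator hI, Measure.restrict_restrict hI, inter_eq_left.2 hsub]
    refine lintegral_congr_ae (hmk.mono fun t ht => ?_)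
    simp only [ht]
  · rw [lintegral_indicator hI, Measure.restrict_restrict hI, Measure.restrict_restrict
      (hI.inter (hS x)), inter_eq_left.2 (inter_subset_left.trans hsub), hJ x hx, inter_comm]
    exact lintegral_congr_ae (ae_mono (Measure.restrict_mono_set _ inter_subset_right)
      (hmk.mono fun t ht => ht.symm))
  · have h' := ae_mono (Measure.restrict_mono_set _ hsub) h
    filter_upwards [h', hmk, ae_restrict_mem hI] with t ht ht2 ht3
    rw [ht2]
    rwa [indicator_of_mem ht3] at ht

lemma hardyConst_eq (hp : 1 ≤ p) : hardyConst p α = |(p - 1 - α) / p| ^ p := by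
  rw [hardyConst, abs_div, abs_of_pos (show 0 < p by linarith), ← abs_neg]
  congr 3
  ring

lemma halfLine_restrict_Iio (x : ℝ) :
    halfLine.restrict (Iio x) = volume.restrict (Ioo 0 x) := by
  rw [Measure.restrict_restrict measurableSet_Iio, inter_comm, Ioi_inter_Iio]

lemma halfLine_restrict_Ioi {x : ℝ} (hx : 0 < x) :
    halfLine.restrict (Ioi x) = volume.restrict (Ioi x) := by
  rw [Measure.restrict_restrict measurableSet_Ioi, Ioi_inter_Ioi, sup_eq_left.2 hx.le]

lemma measurableSet_setOf_mem_Iio : MeasurableSet {q : ℝ × ℝ | q.2 ∈ Iio q.1} :=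
  measurableSet_lt measurable_snd measurable_fst

lemma measurableSet_setOf_mem_Ioi : MeasurableSet {q : ℝ × ℝ | q.2 ∈ Ioi q.1} :=
  measurableSet_lt measurable_fst measurable_snd

lemma hardy_weight_Iio {s : ℝ} (hs : 0 < s) {x : ℝ} (hx : 0 < x) :
    ∫⁻ t in Iio x, ENNReal.ofReal (t ^ (s - 1)) ∂halfLine = ENNReal.ofReal (x ^ s / |s|) := by
  rw [halfLine_restrict_Iio, lintegral_Ioo_rpow hs hx, abs_of_pos hs]

lemma hardy_weight_Ioi {s : ℝ} (hs : s < 0) {x : ℝ} (hx : 0 < x) :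
    ∫⁻ t in Ioi x, ENNReal.ofReal (t ^ (s - 1)) ∂halfLine = ENNReal.ofReal (x ^ s / |s|) := by
  have := lintegral_Ioi_rpow (neg_pos.2 hs) hx
  rw [neg_neg] at this
  rw [halfLine_restrict_Ioi hx, this, abs_of_neg hs]

/-- The half-line inequality for the extension, with the outer integral restricted to (0, b). For p
= 1 Hölder is an identity, and equality is excluded by the part of the outer integral beyond a
finite b. -/
lemma hardy_fromZero_le (b : EReal) (hp : 1 ≤ p) (hα : α < p - 1)
    (hg : AEMeasurable g (volume.restrict (interval b))) :
    (ENNReal.ofReal (hardyConst p α) * ∫⁻ x in interval b,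
      ENNReal.ofReal (x ^ (α - p)) * (∫⁻ t in Ioo 0 x, g t) ^ p ≤
        ∫⁻ x in interval b, ENNReal.ofReal (x ^ α) * g x ^ p) ∧
    (1 < p ∨ b < ⊤ → ∫⁻ x in interval b, ENNReal.ofReal (x ^ α) * g x ^ p ≠ ∞ →
      ∫⁻ x in interval b, ENNReal.ofReal (x ^ α) * g x ^ p ≤ ENNReal.ofReal (hardyConst p α) *
        ∫⁻ x in interval b, ENNReal.ofReal (x ^ (α - p)) * (∫⁻ t in Ioo 0 x, g t) ^ p →
      ∀ᵐ t ∂volume.restrict (interval b), g t = 0) := by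
  have hp0 : 0 < p := by linarith
  have hsub : interval b ⊆ Ioi 0 := fun x hx => hx.1
  have hI := measurableSet_interval b
  obtain ⟨g', hg', e1, e2, e3, e4⟩ := exists_halfLine_extension (S := Iio) (J := fun x => Ioo 0 x)
    (p := p) (α := α) b (fun _ => measurableSet_Iio) (fun x hx => by
      ext t
      exact ⟨fun h => ⟨h.2, h.1, lt_of_le_of_lt (EReal.coe_le_coe_iff.2 h.2.le) hx.2⟩,
        fun h => ⟨h.2.1, h.1⟩⟩) hp0 hg
  set γ := (p - 1 - α) / p with hγdef
  have hγ : 0 < γ := div_pos (by linarith) hp0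
  have hαγ : α = p - 1 - p * γ := by rw [hγdef]; field_simp; ring
  have h1 : ∀ x : ℝ, 0 < x → _ := fun x hx => hardy_weight_Iio hγ hx
  have h2 : ∀ x : ℝ, 0 < x → _ := fun x hx => hardy_weight_Ioi (neg_lt_zero.2 hγ) hx
  simp only [abs_neg] at h2
  have hmain := hardy_of_family hαγ hp hγ.ne' hg' measurableSet_setOf_mem_Iio h1 h2
  have hC : hardyConst p α = |γ| ^ p := hardyConst_eq hp
  have hCpos : 0 < |γ| ^ p := by positivity
  have hE : ∫⁻ x in interval b, ENNReal.ofReal (x ^ (α - p)) * (∫⁻ t in Ioo 0 x, g t) ^ p =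
      ∫⁻ x in interval b, ENNReal.ofReal (x ^ (α - p)) *
        (∫⁻ t in Iio x, g' t ∂halfLine) ^ p :=
    setLIntegral_congr_fun hI fun x hx => by simp only [e2 x hx]
  have hmono : ∫⁻ x in interval b, ENNReal.ofReal (x ^ (α - p)) *
      (∫⁻ t in Iio x, g' t ∂halfLine) ^ p ≤ ∫⁻ x, ENNReal.ofReal (x ^ (α - p)) *
        (∫⁻ t in Iio x, g' t ∂halfLine) ^ p ∂halfLine := lintegral_mono_set hsub
  rw [hC, hE, ← e1]
  refine ⟨(mul_le_mul_right hmono _).trans hmain, fun hpb hfin heq => ?_⟩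
  rcases hp.eq_or_lt with rfl | hp1
  · have hb : b < ⊤ := hpb.resolve_left (lt_irrefl _)
    rcases (interval b).eq_empty_or_nonempty with h0 | ⟨y, hy⟩
    · simp [h0]
    obtain ⟨c, rfl⟩ : ∃ c : ℝ, (c : EReal) = b :=
      ⟨b.toReal, EReal.coe_toReal hb.ne ((bot_lt_of_lt hy.2).ne')⟩
    have hc : 0 < c := hy.1.trans (EReal.coe_lt_coe_iff.1 hy.2)
    refine e3 ?_
    set Φ : ℝ → ℝ≥0∞ := fun x => ENNReal.ofReal (x ^ (α - 1)) *
      (∫⁻ t in Iio x, g' t ∂halfLine) ^ (1 : ℝ)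
    have hIc : interval (c : EReal) = Ioo 0 c := by
      ext t; simp [interval]
    have hsplit : (∫⁻ x in interval (c : EReal), Φ x) + ∫⁻ x in Ici c, Φ x =
        ∫⁻ x, Φ x ∂halfLine := by
      rw [hIc, ← lintegral_union measurableSet_Ici, Ioo_union_Ici_eq_Ioi hc]
      rw [Set.disjoint_left]
      exact fun x hx hx' => not_le.2 hx.2 hx'
    have hfinC : ∫⁻ x in interval (c : EReal), Φ x ≠ ∞ := by
      intro h
      have := (mul_le_mul_right hmono _).trans hmain
      rw [h, ENNReal.mul_top (by simpa using hCpos)] at this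
      exact hfin (top_le_iff.1 this)
    -- Equality leaves no room for the discarded part over [c, ∞). There the inner integral is the
    -- full mass of g', multiplied by a positive weight, so that mass is 0.
    have hzero : ∫⁻ x in Ici c, Φ x = 0 := by
      have h5 := hmain.trans heq
      rw [ENNReal.mul_le_mul_iff_right (by simpa using hCpos) ENNReal.ofReal_ne_top, ← hsplit] at h5
      simpa using ENNReal.le_of_add_le_add_left hfinC (h5.trans_eq (add_zero _).symm)
    have hconst : ∀ x ∈ Ici c, Φ x = ENNReal.ofReal (x ^ (α - 1)) * ∫⁻ t, g' t ∂halfLine := by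
      intro x hx
      simp only [Φ, ENNReal.rpow_one]
      congr 1
      refine setLIntegral_eq_of_support_subset ?_
      intro t ht
      by_contra h
      refine ht (e4 t fun h' => h ?_)
      rw [hIc] at h'
      exact h'.2.trans_le hx
    rw [setLIntegral_congr_fun measurableSet_Ici hconst, lintegral_mul_const _ (by fun_prop),
      mul_eq_zero] at hzero
    rcases hzero with h | h
    · exfalso
      have h6 := setLIntegral_pos_iff (μ := volume) (s := Ici c)
        (f := fun x => ENNReal.ofReal (x ^ (α - 1))) (by fun_prop)
      have h7 : Ici c ⊆ Function.support fun x => ENNReal.ofReal (x ^ (α - 1)) := by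
        intro x hx
        have : 0 < x := hc.trans_le hx
        rw [Function.mem_support, Ne, ENNReal.ofReal_eq_zero, not_le]
        positivity
      rw [h, inter_eq_right.2 h7, Real.volume_Ici] at h6
      simp at h6
    · rwa [lintegral_eq_zero_iff hg'] at h
  · refine e3 (hardy_of_family_eq hαγ hp1 hγ.ne' hg' measurableSet_setOf_mem_Iio h1 h2 ?_ hfin
      (heq.trans (mul_le_mul_right hmono _)))
    intro x hx
    rw [halfLine_restrict_Iio]
    refine lintegral_ofReal_inv_eq_top measurableSet_Ioo (fun t ht => ht.1) fun h => ?_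
    rw [← intervalIntegrable_iff_integrableOn_Ioo_of_le hx.le] at h
    simp [intervalIntegrable_inv_iff, hx.ne] at h

/-- Here truncation at b discards nothing, since the inner integral of the extension vanishes beyond
b. For p = 1 the scalar inequality is therefore an identity, and the equality clause is limited to p
> 1. -/
lemma hardy_toEnd_le (b : EReal) (hp : 1 ≤ p) (hα : p - 1 < α)
    (hg : AEMeasurable g (volume.restrict (interval b))) :
    (ENNReal.ofReal (hardyConst p α) * ∫⁻ x in interval b,
      ENNReal.ofReal (x ^ (α - p)) * (∫⁻ t in {t : ℝ | x < t ∧ (t : EReal) < b}, g t) ^ p ≤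
        ∫⁻ x in interval b, ENNReal.ofReal (x ^ α) * g x ^ p) ∧
    (1 < p → ∫⁻ x in interval b, ENNReal.ofReal (x ^ α) * g x ^ p ≠ ∞ →
      ∫⁻ x in interval b, ENNReal.ofReal (x ^ α) * g x ^ p ≤ ENNReal.ofReal (hardyConst p α) *
        ∫⁻ x in interval b,
          ENNReal.ofReal (x ^ (α - p)) * (∫⁻ t in {t : ℝ | x < t ∧ (t : EReal) < b}, g t) ^ p →
      ∀ᵐ t ∂volume.restrict (interval b), g t = 0) := by
  have hp0 : 0 < p := by linarith
  have hsub : interval b ⊆ Ioi 0 := fun x hx => hx.1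
  have hI := measurableSet_interval b
  obtain ⟨g', hg', e1, e2, e3, e4⟩ := exists_halfLine_extension (S := Ioi)
    (J := fun x => {t : ℝ | x < t ∧ (t : EReal) < b})
    (p := p) (α := α) b (fun _ => measurableSet_Ioi) (fun x hx => by
      ext t
      exact ⟨fun h => ⟨h.1, hx.1.trans h.1, h.2⟩, fun h => ⟨h.1, h.2.2⟩⟩) hp0 hg
  set γ := (p - 1 - α) / p with hγdef
  have hγ : γ < 0 := div_neg_of_neg_of_pos (by linarith) hp0
  have hαγ : α = p - 1 - p * γ := by rw [hγdef]; field_simp; ring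
  have h1 : ∀ x : ℝ, 0 < x → _ := fun x hx => hardy_weight_Ioi hγ hx
  have h2 : ∀ x : ℝ, 0 < x → _ := fun x hx => hardy_weight_Iio (neg_pos.2 hγ) hx
  simp only [abs_neg] at h2
  have hmain := hardy_of_family hαγ hp hγ.ne hg' measurableSet_setOf_mem_Ioi h1 h2
  have hC : hardyConst p α = |γ| ^ p := hardyConst_eq hp
  have hE : ∫⁻ x in interval b,
      ENNReal.ofReal (x ^ (α - p)) * (∫⁻ t in {t : ℝ | x < t ∧ (t : EReal) < b}, g t) ^ p =
      ∫⁻ x in interval b, ENNReal.ofReal (x ^ (α - p)) *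
        (∫⁻ t in Ioi x, g' t ∂halfLine) ^ p :=
    setLIntegral_congr_fun hI fun x hx => by simp only [e2 x hx]
  have hmono : ∫⁻ x in interval b, ENNReal.ofReal (x ^ (α - p)) *
      (∫⁻ t in Ioi x, g' t ∂halfLine) ^ p ≤ ∫⁻ x, ENNReal.ofReal (x ^ (α - p)) *
        (∫⁻ t in Ioi x, g' t ∂halfLine) ^ p ∂halfLine := lintegral_mono_set hsub
  rw [hC, hE, ← e1]
  refine ⟨(mul_le_mul_right hmono _).trans hmain, fun hp1 hfin heq => ?_⟩
  refine e3 (hardy_of_family_eq hαγ hp1 hγ.ne hg' measurableSet_setOf_mem_Ioi h1 h2 ?_ hfin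
      (heq.trans (mul_le_mul_right hmono _)))
  intro x hx
  rw [halfLine_restrict_Ioi hx]
  exact lintegral_ofReal_inv_eq_top measurableSet_Ioi (Ioi_subset_Ioi hx.le) not_integrableOn_Ioi_inv

end ScalarHardy

/-! ### From traces of operator integrals to scalar integrals -/

section Traces

universe u

variable {H : Type u} [NormedAddCommGroup H] [InnerProductSpace ℂ H] [CompleteSpace H]

lemma schattenNorm_rpow {p : ℝ} (hp : 0 < p) (T : H →L[ℂ] H) :
    schattenNorm p T ^ p = posTrace (absPow p T) := by
  rw [schattenNorm, one_div, ENNReal.rpow_inv_rpow hp.ne']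

lemma schattenNorm_one_of_nonneg {A : H →L[ℂ] H} (hA : 0 ≤ A) : schattenNorm 1 A = posTrace A := by
  rw [schattenNorm, absPow, CFC.abs_of_nonneg A hA, CFC.rpow_one A hA]
  simp

lemma trace_eq_toReal {A : H →L[ℂ] H} (hA : 0 ≤ A) :
    trace A = ((posTrace A).toReal : ℂ) := by
  rw [trace, posTrace, ENNReal.tsum_toReal_eq fun i => ENNReal.ofReal_ne_top, Complex.ofReal_tsum]
  refine tsum_congr fun i => ?_
  rw [ENNReal.toReal_ofReal (re_inner_nonneg hA _), ofReal_re_inner_eq hA]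

lemma schattenNorm_eq_zero_iff {p : ℝ} (hp : 0 < p) (T : H →L[ℂ] H) :
    schattenNorm p T = 0 ↔ T = 0 := by
  constructor
  · intro h
    have := enorm_le_schattenNorm hp T
    rw [h, nonpos_iff_eq_zero, enorm_eq_zero] at this
    exact this
  · rintro rfl
    have : absPow p (0 : H →L[ℂ] H) = 0 := by
      rw [← norm_eq_zero, norm_absPow hp, norm_zero, Real.zero_rpow hp.ne']
    rw [schattenNorm, this]
    simp [posTrace, hp]

lemma weightedAbsPow_nonneg (p β : ℝ) (G : ℝ → H →L[ℂ] H) {x : ℝ} (hx : 0 < x) :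
    0 ≤ weightedAbsPow p β G x :=
  smul_nonneg (by positivity) (absPow_nonneg p (G x))

variable [TopologicalSpace.SeparableSpace H] {p α β : ℝ} {b : EReal} {F G : ℝ → H →L[ℂ] H}

lemma ae_interval_pos (b : EReal) : ∀ᵐ x ∂volume.restrict (interval b), 0 < x :=
  (ae_restrict_mem (measurableSet_interval b)).mono fun _ hx => hx.1

lemma integrableOn_weightedAbsPow (hp : 0 < p)
    (hG : AEStronglyMeasurable G (volume.restrict (interval b)))
    (h : ∫⁻ x in interval b, ENNReal.ofReal (x ^ β) * schattenNorm p (G x) ^ p ≠ ∞) :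
    IntegrableOn (weightedAbsPow p β G) (interval b) := by
  refine ⟨?_, ?_⟩
  · have h1 := (continuous_absPow hp).comp_aestronglyMeasurable hG
    have h2 : AEStronglyMeasurable (fun x : ℝ => x ^ β) (volume.restrict (interval b)) := by
      fun_prop
    exact h2.smul h1
  · rw [hasFiniteIntegral_iff_enorm]
    refine lt_of_le_of_lt (lintegral_mono_ae ?_) h.lt_top
    filter_upwards [ae_interval_pos b] with x hx
    rw [weightedAbsPow, enorm_smul, Real.enorm_of_nonneg (by positivity), schattenNorm_rpow hp]
    gcongr
    exact enorm_le_posTrace (absPow_nonneg p _)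

lemma inner_weightedIntegral (hi : IntegrableOn (weightedAbsPow p β G) (interval b)) (v : H) :
    (inner ℂ v (weightedIntegral p β b G v) : ℂ) =
      ∫ x in interval b, (inner ℂ v (weightedAbsPow p β G x v) : ℂ) := by
  let L : (H →L[ℂ] H) →L[ℂ] ℂ := innerSL ℂ v ∘L ContinuousLinearMap.apply ℂ H v
  exact (L.integral_comp_comm hi).symm

lemma weightedIntegral_nonneg (p β : ℝ) (b : EReal) (G : ℝ → H →L[ℂ] H) :
    0 ≤ weightedIntegral p β b G :=
  integral_nonneg_of_ae ((ae_interval_pos b).mono fun _ hx => weightedAbsPow_nonneg p β G hx)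

/-- Each diagonal element is a continuous functional and commutes with the Bochner integral; the sum
over the basis is then exchanged with the integral by nonnegativity. -/
lemma posTrace_weightedIntegral (hp : 0 < p)
    (hi : IntegrableOn (weightedAbsPow p β G) (interval b)) :
    posTrace (weightedIntegral p β b G) =
      ∫⁻ x in interval b, ENNReal.ofReal (x ^ β) * schattenNorm p (G x) ^ p := by
  have h1 : ∀ i, ENNReal.ofReal (inner ℂ (onb H i) (weightedIntegral p β b G (onb H i))).re =
      ∫⁻ x in interval b,
        ENNReal.ofReal (inner ℂ (onb H i) (weightedAbsPow p β G x (onb H i))).re := fun i => by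
    have hint : IntegrableOn (fun x => (inner ℂ (onb H i) (weightedAbsPow p β G x (onb H i)) : ℂ))
        (interval b) :=
      (innerSL ℂ (onb H i) ∘L ContinuousLinearMap.apply ℂ H (onb H i)).integrable_comp hi
    rw [inner_weightedIntegral hi]
    refine Eq.trans ?_ (ofReal_integral_eq_lintegral_ofReal hint.re ?_)
    · congr 1
      exact (integral_re hint).symm
    · exact (ae_interval_pos b).mono fun x hx =>
        re_inner_nonneg (weightedAbsPow_nonneg p β G hx) _
  rw [posTrace]
  simp_rw [h1]
  rw [← lintegral_tsum]
  · refine lintegral_congr_ae ((ae_interval_pos b).mono fun x hx => ?_)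
    simp only
    rw [schattenNorm_rpow hp, posTrace, ← ENNReal.tsum_mul_left]
    refine tsum_congr fun i => ?_
    rw [weightedAbsPow, smul_apply, inner_smul_right_eq_smul, Complex.real_smul,
      Complex.re_ofReal_mul, ENNReal.ofReal_mul (by positivity)]
  · intro i
    have hc : Continuous fun T : H →L[ℂ] H => (inner ℂ (onb H i) (T (onb H i)) : ℂ).re := by
      fun_prop
    exact (hc.comp_aestronglyMeasurable hi.1).aemeasurable.ennreal_ofReal

lemma trace_weightedIntegral (hp : 0 < p)
    (hG : AEStronglyMeasurable G (volume.restrict (interval b)))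
    (h : ∫⁻ x in interval b, ENNReal.ofReal (x ^ β) * schattenNorm p (G x) ^ p ≠ ∞) :
    IntegrableOn (weightedAbsPow p β G) (interval b) ∧ IsTraceClass (weightedIntegral p β b G) ∧
      trace (weightedIntegral p β b G) =
        ((∫⁻ x in interval b, ENNReal.ofReal (x ^ β) * schattenNorm p (G x) ^ p).toReal : ℂ) := by
  have hi := integrableOn_weightedAbsPow hp hG h
  have h1 := posTrace_weightedIntegral hp hi
  have h2 := weightedIntegral_nonneg p β b G
  refine ⟨hi, ?_, ?_⟩
  · rw [IsTraceClass, schattenNorm_one_of_nonneg h2, h1]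
    exact h.lt_top
  · rw [trace_eq_toReal h2, h1]

lemma IsAdmissible.lintegral_ne_top (hp : 1 ≤ p) (hF : IsAdmissible p α b F) :
    ∫⁻ x in interval b, ENNReal.ofReal (x ^ α) * schattenNorm p (F x) ^ p ≠ ∞ := by
  have hp0 : 0 < p := by linarith
  have h := hF.memLp
  have h1 := lintegral_rpow_enorm_lt_top_of_eLpNorm_lt_top (by simpa using hp0)
    ENNReal.ofReal_ne_top h.2
  rw [ENNReal.toReal_ofReal hp0.le, lintegral_withDensity_eq_lintegral_mul₀' (by fun_prop)
    (h.1.aemeasurable.enorm.pow_const _)] at h1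
  exact h1.ne

lemma IsAdmissible.ae_ne_top (hp : 1 ≤ p) (hF : IsAdmissible p α b F) :
    ∀ᵐ x ∂volume.restrict (interval b), schattenNorm p (F x) ≠ ∞ := by
  have hp0 : 0 < p := by linarith
  have h := hF.memLp
  have h1 := lintegral_rpow_enorm_lt_top_of_eLpNorm_lt_top (by simpa using hp0)
    ENNReal.ofReal_ne_top h.2
  have h2 := ae_lt_top' (h.1.aemeasurable.enorm.pow_const _) h1.ne
  rw [ae_withDensity_iff (by fun_prop)] at h2
  filter_upwards [h2, ae_interval_pos b] with x hx hx0 htop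
  have h3 := hx (by rw [Ne, ENNReal.ofReal_eq_zero, not_le]; positivity)
  rw [htop, ENNReal.toReal_ofReal hp0.le] at h3
  simp [hp0] at h3

lemma IsAdmissible.ae_isApproximable (hp : 1 ≤ p) (hF : IsAdmissible p α b F) :
    ∀ᵐ x ∂volume.restrict (interval b), IsApproximable (F x) :=
  (hF.ae_ne_top hp).mono fun _ hx => isApproximable_of_schattenNorm_ne_top (by linarith) hx

lemma IsAdmissible.aestronglyMeasurable (hp : 1 ≤ p) (hF : IsAdmissible p α b F) :
    AEStronglyMeasurable F (volume.restrict (interval b)) :=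
  aestronglyMeasurable_of_weaklyMeasurable hF.weaklyMeasurable (hF.ae_isApproximable hp)

lemma aestronglyMeasurable_setIntegral {J : ℝ → Set ℝ}
    (hJm : MeasurableSet {q : ℝ × ℝ | q.2 ∈ J q.1}) (hJ : ∀ x ∈ interval b, J x ⊆ interval b)
    (hF : AEStronglyMeasurable F (volume.restrict (interval b))) :
    AEStronglyMeasurable (fun x => ∫ t in J x, F t) (volume.restrict (interval b)) := by
  have h1 : AEStronglyMeasurable ({q : ℝ × ℝ | q.2 ∈ J q.1}.indicator fun q => F q.2)
      ((volume.restrict (interval b)).prod (volume.restrict (interval b))) :=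
    hF.comp_snd.indicator hJm
  refine h1.integral_prod_right'.congr ?_
  filter_upwards [ae_restrict_mem (measurableSet_interval b)] with x hx
  have hJx : MeasurableSet (J x) := (measurable_prodMk_left (x := x)) hJm
  have : ∀ t, {q : ℝ × ℝ | q.2 ∈ J q.1}.indicator (fun q => F q.2) (x, t) = (J x).indicator F t :=
    fun t => rfl
  simp_rw [this]
  rw [integral_indicator hJx, Measure.restrict_restrict hJx, inter_eq_left.2 (hJ x hx)]

/-- The operator-valued Hardy inequality follows from a scalar one. -/
lemma operator_hardy_of_scalar {J : ℝ → Set ℝ} {c : ℝ} {P : Prop} (hp : 1 ≤ p) (hc : 0 < c)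
    (hF : IsAdmissible p α b F) (hJm : MeasurableSet {q : ℝ × ℝ | q.2 ∈ J q.1})
    (hJ : ∀ x ∈ interval b, J x ⊆ interval b)
    (hJfin : ∀ x ∈ interval b, ∫⁻ t in J x, schattenNorm p (F t) ≠ ∞)
    (hle : ENNReal.ofReal c * ∫⁻ x in interval b,
      ENNReal.ofReal (x ^ (α - p)) * (∫⁻ t in J x, schattenNorm p (F t)) ^ p ≤
        ∫⁻ x in interval b, ENNReal.ofReal (x ^ α) * schattenNorm p (F x) ^ p)
    (heq : P → ∫⁻ x in interval b, ENNReal.ofReal (x ^ α) * schattenNorm p (F x) ^ p ≠ ∞ →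
      ∫⁻ x in interval b, ENNReal.ofReal (x ^ α) * schattenNorm p (F x) ^ p ≤
        ENNReal.ofReal c * ∫⁻ x in interval b,
          ENNReal.ofReal (x ^ (α - p)) * (∫⁻ t in J x, schattenNorm p (F t)) ^ p →
      ∀ᵐ t ∂volume.restrict (interval b), schattenNorm p (F t) = 0) :
    (∀ x ∈ interval b, IntegrableOn F (J x)) ∧
    IntegrableOn (weightedAbsPow p α F) (interval b) ∧
    IntegrableOn (weightedAbsPow p (α - p) fun x => ∫ t in J x, F t) (interval b) ∧
    IsTraceClass (weightedIntegral p α b F) ∧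
    IsTraceClass (weightedIntegral p (α - p) b fun x => ∫ t in J x, F t) ∧
    (c : ℂ) * trace (weightedIntegral p (α - p) b fun x => ∫ t in J x, F t) ≤
      trace (weightedIntegral p α b F) ∧
    (P → (trace (weightedIntegral p α b F) =
        (c : ℂ) * trace (weightedIntegral p (α - p) b fun x => ∫ t in J x, F t) ↔
      ∀ᵐ x ∂(volume.restrict (interval b)), F x = 0)) := by
  have hp0 : 0 < p := by linarith
  have hFm := hF.aestronglyMeasurable hp
  have hA := hF.lintegral_ne_top hp
  have hFJ : ∀ x ∈ interval b, IntegrableOn F (J x) := fun x hx =>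
    ⟨hFm.mono_set (hJ x hx), lt_of_le_of_lt
      (lintegral_mono fun t => enorm_le_schattenNorm hp0 (F t)) (hJfin x hx).lt_top⟩
  have hGm := aestronglyMeasurable_setIntegral hJm hJ hFm
  set A := ∫⁻ x in interval b, ENNReal.ofReal (x ^ α) * schattenNorm p (F x) ^ p
  set G : ℝ → H →L[ℂ] H := fun x => ∫ t in J x, F t
  have hGle : ∀ x ∈ interval b, schattenNorm p (G x) ≤ ∫⁻ t in J x, schattenNorm p (F t) := by
    intro x hx
    have hap : ∀ᵐ t ∂volume.restrict (J x), IsApproximable (F t) := ae_mono (Measure.restrict_mono_set _ (hJ x hx))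
      (hF.ae_isApproximable hp)
    exact schattenNorm_integral_le hp (hFJ x hx) (hap.mono fun t ht => ht.isCompactOperator)
      (isApproximable_integral (hFJ x hx) hap).isCompactOperator
  have hBle : ∫⁻ x in interval b, ENNReal.ofReal (x ^ (α - p)) * schattenNorm p (G x) ^ p ≤
      ∫⁻ x in interval b,
        ENNReal.ofReal (x ^ (α - p)) * (∫⁻ t in J x, schattenNorm p (F t)) ^ p :=
    lintegral_mono_ae ((ae_restrict_mem (measurableSet_interval b)).mono fun x hx => by
      gcongr
      exact hGle x hx)
  set B := ∫⁻ x in interval b, ENNReal.ofReal (x ^ (α - p)) * schattenNorm p (G x) ^ p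
  have hcB : ENNReal.ofReal c * B ≤ A := (mul_le_mul_right hBle _).trans hle
  have hB : B ≠ ∞ := by
    intro h
    rw [h, ENNReal.mul_top (by simpa using hc)] at hcB
    exact hA (top_le_iff.1 hcB)
  obtain ⟨iF, tF, eF⟩ := trace_weightedIntegral hp0 hFm hA
  obtain ⟨iG, tG, eG⟩ := trace_weightedIntegral hp0 hGm hB
  refine ⟨hFJ, iF, iG, tF, tG, ?_, fun hP => ?_⟩
  · rw [eF, eG, ← Complex.ofReal_mul, Complex.real_le_real]
    have := ENNReal.toReal_mono hA hcB
    rwa [ENNReal.toReal_mul, ENNReal.toReal_ofReal hc.le] at this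
  · rw [eF, eG, ← Complex.ofReal_mul, Complex.ofReal_inj]
    change A.toReal = c * B.toReal ↔ _
    constructor
    · intro h
      have h1 : A ≤ ENNReal.ofReal c * B := by
        rw [← ENNReal.ofReal_toReal hA, ← ENNReal.ofReal_toReal hB, ← ENNReal.ofReal_mul hc.le]
        exact ENNReal.ofReal_le_ofReal h.le
      -- Equality of traces gives A ≤ cB, and Minkowski bounds B by the scalar Hardy integral, so
      -- the scalar equality case applies to ‖F(·)‖_p.
      exact (heq hP hA (h1.trans (mul_le_mul_right hBle _))).mono fun x hx =>
        (schattenNorm_eq_zero_iff hp0 (F x)).1 hx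
    · intro h
      have hA0 : A = 0 := by
        refine (lintegral_congr_ae (h.mono fun x hx => ?_)).trans lintegral_zero
        rw [hx, (schattenNorm_eq_zero_iff hp0 0).2 rfl, ENNReal.zero_rpow_of_pos hp0, mul_zero]
      have hB0 : B = 0 := by
        rw [hA0, nonpos_iff_eq_zero, mul_eq_zero] at hcB
        exact hcB.resolve_left (by simpa using hc)
      simp [hA0, hB0]

/-- An everywhere defined monotone-type quantity whose weighted power is integrable is finite as
soon as each point has an open set of points with larger values. -/
lemma ne_top_of_lintegral_ne_top {Φ : ℝ → ℝ≥0∞} {β : ℝ} (hp : 0 < p)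
    (h : ∫⁻ x in interval b, ENNReal.ofReal (x ^ β) * Φ x ^ p ≠ ∞) {x : ℝ} {U : Set ℝ}
    (hU : IsOpen U) (hne : U.Nonempty) (hUI : U ⊆ interval b) (hx : ∀ y ∈ U, Φ x ≤ Φ y) :
    Φ x ≠ ∞ := by
  intro htop
  apply h
  rw [← top_le_iff]
  calc ∞ = ∫⁻ y in U, ∞ := by
        rw [setLIntegral_const, ENNReal.top_mul (hU.measure_pos _ hne).ne']
    _ ≤ ∫⁻ y in U, ENNReal.ofReal (y ^ β) * Φ y ^ p := by
        refine setLIntegral_mono' hU.measurableSet fun y hy => ?_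
        have h1 : Φ y = ∞ := top_le_iff.1 (htop ▸ hx y hy)
        have h2 : 0 < y := (hUI hy).1
        rw [h1, ENNReal.top_rpow_of_pos hp, ENNReal.mul_top]
        rw [Ne, ENNReal.ofReal_eq_zero, not_le]
        positivity
    _ ≤ _ := lintegral_mono_set hUI

lemma ne_top_of_ofReal_mul_le {c : ℝ} (hc : 0 < c) {A B : ℝ≥0∞} (h : ENNReal.ofReal c * B ≤ A)
    (hA : A ≠ ∞) : B ≠ ∞ := by
  rintro rfl
  rw [ENNReal.mul_top (by simpa using hc)] at h
  exact hA (top_le_iff.1 h)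

lemma hardyConst_pos (hp : 1 ≤ p) (hα : α ≠ p - 1) : 0 < hardyConst p α := by
  have : 0 < |α - p + 1| := abs_pos.2 fun h => hα (by linarith)
  have hp0 : 0 < p := by linarith
  unfold hardyConst
  positivity

lemma operator_hardy_fromZero (hp : 1 ≤ p) (hα : α < p - 1) (hF : IsAdmissible p α b F) :
    (∀ x ∈ interval b, IntegrableOn F (Ioo 0 x)) ∧
    IntegrableOn (weightedAbsPow p α F) (interval b) ∧
    IntegrableOn (weightedAbsPow p (α - p) (integralFromZero F)) (interval b) ∧
    IsTraceClass (weightedIntegral p α b F) ∧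
    IsTraceClass (weightedIntegral p (α - p) b (integralFromZero F)) ∧
    (hardyConst p α : ℂ) * trace (weightedIntegral p (α - p) b (integralFromZero F)) ≤
      trace (weightedIntegral p α b F) ∧
    (1 < p ∨ b < ⊤ → (trace (weightedIntegral p α b F) =
        (hardyConst p α : ℂ) * trace (weightedIntegral p (α - p) b (integralFromZero F)) ↔
      ∀ᵐ x ∂(volume.restrict (interval b)), F x = 0)) := by
  have hc := hardyConst_pos hp hα.ne
  have hp0 : 0 < p := by linarith
  have hg := aemeasurable_schattenNorm_comp hp0 (hF.aestronglyMeasurable hp)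
  obtain ⟨h1, h2⟩ := hardy_fromZero_le b hp hα hg
  refine operator_hardy_of_scalar (J := fun x => Ioo 0 x) hp hc hF ?_ ?_ ?_ h1 h2
  · exact (measurableSet_lt measurable_const measurable_snd).inter
      (measurableSet_lt measurable_snd measurable_fst)
  · exact fun x hx t ht => ⟨ht.1, lt_trans (EReal.coe_lt_coe_iff.2 ht.2) hx.2⟩
  · intro x hx
    -- Integrability of F on (0, x) follows from Hardy itself: the inner integral increases with x,
    -- so an infinite value at x would persist on (x, y) and make the Hardy integral infinite.
    obtain ⟨y, hxy, hyb⟩ := EReal.lt_iff_exists_real_btwn.1 hx.2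
    refine ne_top_of_lintegral_ne_top (Φ := fun x => ∫⁻ t in Ioo 0 x, schattenNorm p (F t)) hp0
      (ne_top_of_ofReal_mul_le hc h1 (hF.lintegral_ne_top hp)) (U := Ioo x y) isOpen_Ioo
      (nonempty_Ioo.2 (EReal.coe_lt_coe_iff.1 hxy)) ?_ ?_
    · exact fun t ht => ⟨hx.1.trans ht.1, lt_trans (EReal.coe_lt_coe_iff.2 ht.2) hyb⟩
    · exact fun t ht => lintegral_mono_set (Ioo_subset_Ioo_right ht.1.le)

lemma operator_hardy_toEnd (hp : 1 ≤ p) (hα : p - 1 < α) (hF : IsAdmissible p α b F) :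
    (∀ x ∈ interval b, IntegrableOn F {t : ℝ | x < t ∧ (t : EReal) < b}) ∧
    IntegrableOn (weightedAbsPow p α F) (interval b) ∧
    IntegrableOn (weightedAbsPow p (α - p) (integralToEnd b F)) (interval b) ∧
    IsTraceClass (weightedIntegral p α b F) ∧
    IsTraceClass (weightedIntegral p (α - p) b (integralToEnd b F)) ∧
    (hardyConst p α : ℂ) * trace (weightedIntegral p (α - p) b (integralToEnd b F)) ≤
      trace (weightedIntegral p α b F) ∧
    (1 < p → (trace (weightedIntegral p α b F) =
        (hardyConst p α : ℂ) * trace (weightedIntegral p (α - p) b (integralToEnd b F)) ↔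
      ∀ᵐ x ∂(volume.restrict (interval b)), F x = 0)) := by
  have hc := hardyConst_pos hp hα.ne'
  have hp0 : 0 < p := by linarith
  have hg := aemeasurable_schattenNorm_comp hp0 (hF.aestronglyMeasurable hp)
  obtain ⟨h1, h2⟩ := hardy_toEnd_le b hp hα hg
  refine operator_hardy_of_scalar (J := fun x => {t : ℝ | x < t ∧ (t : EReal) < b}) hp hc hF
    ?_ ?_ ?_ h1 h2
  · exact (measurableSet_lt measurable_fst measurable_snd).inter
      (measurableSet_lt (measurable_coe_real_ereal.comp measurable_snd) measurable_const)
  · exact fun x hx t ht => ⟨hx.1.trans ht.1, ht.2⟩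
  · intro x hx
    -- The inner integral now decreases in x, so an infinite value would persist on (0, x).
    refine ne_top_of_lintegral_ne_top
      (Φ := fun x => ∫⁻ t in {t : ℝ | x < t ∧ (t : EReal) < b}, schattenNorm p (F t)) hp0
      (ne_top_of_ofReal_mul_le hc h1 (hF.lintegral_ne_top hp)) (U := Ioo 0 x) isOpen_Ioo
      (nonempty_Ioo.2 hx.1) ?_ ?_
    · exact fun t ht => ⟨ht.1, lt_trans (EReal.coe_lt_coe_iff.2 ht.2) hx.2⟩
    · exact fun y hy => lintegral_mono_set fun t ht => ⟨hy.2.trans ht.1, ht.2⟩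

end Traces

/-! ### Optimality of the constant -/

section Sharpness

universe u

variable {H : Type u} [NormedAddCommGroup H] [InnerProductSpace ℂ H] [CompleteSpace H]

/-- Completing e to a Hilbert basis diagonalizes T*T, with r² as the only possibly nonzero
eigenvalue. -/
lemma schattenNorm_smul_rankOne {e : H} (he : ‖e‖ = 1) {p : ℝ} (hp : 0 < p) (r : ℝ) :
    schattenNorm p (r • (InnerProductSpace.rankOne ℂ e e : H →L[ℂ] H)) = ‖r‖ₑ := by
  set T : H →L[ℂ] H := r • (InnerProductSpace.rankOne ℂ e e : H →L[ℂ] H) with hT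
  have hTapp : ∀ v, T v = (r : ℂ) • ((inner ℂ e v : ℂ) • e) := fun v => by
    simp [hT]
  have hee : (inner ℂ e e : ℂ) = 1 := by rw [inner_self_eq_norm_sq_to_K, he]; simp
  have hTs : star T = T := by
    rw [hT, star_smul, ContinuousLinearMap.star_eq_adjoint, InnerProductSpace.adjoint_rankOne]
    simp
  have hsm : ∀ v, (star T * T) v = ((r ^ 2 : ℝ) : ℂ) • ((inner ℂ e v : ℂ) • e) := fun v => by
    rw [mul_apply_eq_comp, hTs, hTapp (T v), hTapp v]
    simp only [inner_smul_right, hee, mul_one, smul_smul]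
    congr 1
    push_cast
    ring
  have hone : Orthonormal ℂ ((↑) : ({e} : Set H) → H) :=
    ⟨fun v => by rw [show (v : H) = e from v.2, he], fun v w hvw => (hvw (Subsingleton.elim v w)).elim⟩
  obtain ⟨w, b, hw, hb⟩ := hone.exists_hilbertBasis_extension
  have hew : e ∈ w := hw rfl
  have htr : posTrace (absPow p T) = ‖r‖ₑ ^ p := by
    rw [posTrace_eq_tsum b (absPow_nonneg p T), tsum_eq_single ⟨e, hew⟩]
    · have hbe : b ⟨e, hew⟩ = e := by rw [hb]
      rw [hbe, absPow_eq hp.le, rpow_apply_eigenvector (star_mul_self_nonneg T) (by positivity)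
        (l := r ^ 2) (by rw [hsm, hee, one_smul]), inner_smul_right, hee, mul_one,
        Complex.ofReal_re, ← ofReal_norm, ENNReal.ofReal_rpow_of_nonneg (norm_nonneg _) hp.le,
        Real.norm_eq_abs, ← sq_abs, ← Real.rpow_natCast_mul (abs_nonneg r)]
      congr 2
      push_cast
      ring
    · intro i hi
      have hin : (inner ℂ e (b i) : ℂ) = 0 := by
        have := b.orthonormal.2 hi.symm
        rwa [hb] at this ⊢
      rw [absPow_eq hp.le, rpow_apply_eigenvector (star_mul_self_nonneg T) (by positivity)
        (l := 0) (by rw [hsm, hin]; simp), Real.zero_rpow (by positivity)]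
      simp
  rw [schattenNorm, htr, one_div, ENNReal.rpow_rpow_inv hp.ne']

variable [TopologicalSpace.SeparableSpace H] {p α : ℝ} {b : EReal}

lemma isAdmissible_smul_rankOne {e : H} (he : ‖e‖ = 1) (hp : 1 ≤ p) {f : ℝ → ℝ} (hf : Measurable f)
    (hA : ∫⁻ x in interval b, ENNReal.ofReal (x ^ α) * ‖f x‖ₑ ^ p ≠ ∞) :
    IsAdmissible p α b fun x => f x • (InnerProductSpace.rankOne ℂ e e : H →L[ℂ] H) := by
  have hp0 : 0 < p := by linarith
  refine ⟨fun u v => ?_, ?_, ?_⟩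
  · have : ∀ x, (inner ℂ u ((f x • (InnerProductSpace.rankOne ℂ e e : H →L[ℂ] H)) v) : ℂ) =
        (f x : ℂ) * inner ℂ u ((InnerProductSpace.rankOne ℂ e e : H →L[ℂ] H) v) := fun x => by
      rw [smul_apply, inner_smul_right_eq_smul, Complex.real_smul]
    simp_rw [this]
    fun_prop
  · simp_rw [schattenNorm_smul_rankOne he hp0]
    exact hf.enorm.aestronglyMeasurable
  · simp_rw [schattenNorm_smul_rankOne he hp0]
    rw [eLpNorm_lt_top_iff_lintegral_rpow_enorm_lt_top (by simpa using hp0) ENNReal.ofReal_ne_top]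
    rw [ENNReal.toReal_ofReal hp0.le, lintegral_withDensity_eq_lintegral_mul₀' (by fun_prop)
      (by fun_prop)]
    exact hA.lt_top

/-- The operator inequality applied to a multiple of a fixed one-dimensional projection. -/
lemma scalar_le_of_operator_le {J : ℝ → Set ℝ} {C : ℝ} [Nontrivial H] (hp : 1 ≤ p)
    (hJm : MeasurableSet {q : ℝ × ℝ | q.2 ∈ J q.1}) (hJ : ∀ x ∈ interval b, J x ⊆ interval b)
    (hC : ∀ F : ℝ → H →L[ℂ] H, IsAdmissible p α b F →
      (C : ℂ) * trace (weightedIntegral p (α - p) b fun x => ∫ t in J x, F t) ≤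
        trace (weightedIntegral p α b F))
    {f : ℝ → ℝ} (hf : Measurable f)
    (hA : ∫⁻ x in interval b, ENNReal.ofReal (x ^ α) * ‖f x‖ₑ ^ p ≠ ∞)
    (hB : ∫⁻ x in interval b, ENNReal.ofReal (x ^ (α - p)) * (∫⁻ t in J x, ‖f t‖ₑ) ^ p ≠ ∞) :
    ∫⁻ x in interval b, ENNReal.ofReal (x ^ (α - p)) * ‖∫ t in J x, f t‖ₑ ^ p ≠ ∞ ∧
    C * (∫⁻ x in interval b, ENNReal.ofReal (x ^ (α - p)) * ‖∫ t in J x, f t‖ₑ ^ p).toReal ≤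
      (∫⁻ x in interval b, ENNReal.ofReal (x ^ α) * ‖f x‖ₑ ^ p).toReal := by
  have hp0 : 0 < p := by linarith
  obtain ⟨e, he⟩ := exists_norm_eq H zero_le_one
  set T : H →L[ℂ] H := InnerProductSpace.rankOne ℂ e e
  have hF : IsAdmissible p α b fun x => f x • T := isAdmissible_smul_rankOne he hp hf hA
  have hFm := hF.aestronglyMeasurable hp
  have hGm := aestronglyMeasurable_setIntegral hJm hJ hFm
  have hG : ∀ x, ∫ t in J x, f t • T = (∫ t in J x, f t) • T := fun x => integral_smul_const f T
  have hB' : ∫⁻ x in interval b, ENNReal.ofReal (x ^ (α - p)) * ‖∫ t in J x, f t‖ₑ ^ p ≠ ∞ := by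
    refine ne_top_of_le_ne_top hB (lintegral_mono fun x => ?_)
    gcongr
    exact enorm_integral_le_lintegral_enorm _
  have hFn : ∀ r : ℝ, schattenNorm p (r • T) = ‖r‖ₑ := schattenNorm_smul_rankOne he hp0
  have h1 := (trace_weightedIntegral (β := α) hp0 hFm (by simp_rw [hFn]; exact hA)).2.2
  have h2 := (trace_weightedIntegral (β := α - p) hp0 hGm
    (by simp_rw [hG, hFn]; exact hB')).2.2
  have h3 := hC _ hF
  rw [h1, h2, ← Complex.ofReal_mul, Complex.real_le_real] at h3
  simp_rw [hG, hFn] at h3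
  exact ⟨hB', h3⟩

lemma mul_le_one_of_mul_toReal_le {C k : ℝ} {A B : ℝ≥0∞} (hC : 0 ≤ C)
    (h : C * B.toReal ≤ A.toReal) (hA0 : A ≠ 0) (hA : A ≠ ∞) (hB : B ≠ ∞) (hk : 0 ≤ k)
    (hkA : ENNReal.ofReal k * A ≤ B) : C * k ≤ 1 := by
  have h1 := ENNReal.toReal_mono hB hkA
  rw [ENNReal.toReal_mul, ENNReal.toReal_ofReal hk] at h1
  have h2 : 0 < A.toReal := ENNReal.toReal_pos hA0 hA
  have h3 : C * (k * A.toReal) ≤ A.toReal := (mul_le_mul_of_nonneg_left h1 hC).trans h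
  rw [← mul_assoc] at h3
  exact (mul_le_iff_le_one_left h2).1 h3

/-- A power function cut off at `c`. -/
noncomputable def cutPower (c s : ℝ) : ℝ → ℝ := (Ioo 0 c).indicator fun t => t ^ (s - 1)

lemma measurable_cutPower (c s : ℝ) : Measurable (cutPower c s) :=
  Measurable.indicator (by fun_prop) measurableSet_Ioo

lemma Ioo_subset_interval {c : ℝ} (hcb : (c : EReal) < b) : Ioo 0 c ⊆ interval b :=
  fun _ ht => ⟨ht.1, lt_trans (EReal.coe_lt_coe_iff.2 ht.2) hcb⟩

/-- The relation `hs` says s = γ + ε with γ = (p - 1 - α)/p: the integrand is t^(εp-1), barely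
integrable at 0. -/
lemma lintegral_cutPower {c s ε : ℝ} (hp : 1 ≤ p) (hs : α + (s - 1) * p = ε * p - 1) (hε : 0 < ε)
    (hc : 0 < c) (hcb : (c : EReal) < b) :
    ∫⁻ x in interval b, ENNReal.ofReal (x ^ α) * ‖cutPower c s x‖ₑ ^ p =
      ENNReal.ofReal (c ^ (ε * p) / (ε * p)) := by
  have hp0 : 0 < p := by linarith
  rw [← lintegral_Ioo_rpow (by positivity) hc]
  have e : ∀ x, ENNReal.ofReal (x ^ α) * ‖cutPower c s x‖ₑ ^ p =
      (Ioo 0 c).indicator (fun x => ENNReal.ofReal (x ^ (ε * p - 1))) x := fun x => by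
    by_cases hx : x ∈ Ioo 0 c
    · rw [cutPower, indicator_of_mem hx, indicator_of_mem hx,
        Real.enorm_of_nonneg (Real.rpow_nonneg hx.1.le _), ofReal_rpow_rpow hx.1 _ hp0.le,
        ofReal_rpow_mul hx.1, hs]
    · rw [cutPower, indicator_of_notMem hx, indicator_of_notMem hx, enorm_zero,
        ENNReal.zero_rpow_of_pos hp0, mul_zero]
  simp_rw [e]
  rw [lintegral_indicator measurableSet_Ioo, Measure.restrict_restrict measurableSet_Ioo,
    inter_eq_left.2 (Ioo_subset_interval hcb)]

lemma le_lintegral_of_forall_le {s ε c k : ℝ} {Φ : ℝ → ℝ≥0∞} (hp : 1 ≤ p)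
    (hs : α + (s - 1) * p = ε * p - 1) (hε : 0 < ε)
    (hc : 0 < c) (hcb : (c : EReal) < b) (hk : 0 ≤ k)
    (hΦ : ∀ x ∈ Ioo 0 c, ENNReal.ofReal (k * x ^ s) ≤ Φ x) :
    ENNReal.ofReal (k ^ p) * ENNReal.ofReal (c ^ (ε * p) / (ε * p)) ≤
      ∫⁻ x in interval b, ENNReal.ofReal (x ^ (α - p)) * Φ x ^ p := by
  have hp0 : 0 < p := by linarith
  rw [← lintegral_Ioo_rpow (by positivity) hc, ← lintegral_const_mul _ (by fun_prop)]
  refine (setLIntegral_mono' measurableSet_Ioo fun x hx => ?_).trans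
    (lintegral_mono_set (Ioo_subset_interval hcb))
  calc ENNReal.ofReal (k ^ p) * ENNReal.ofReal (x ^ (ε * p - 1))
      = ENNReal.ofReal (x ^ (α - p)) * ENNReal.ofReal (k * x ^ s) ^ p := by
        rw [ENNReal.ofReal_mul hk, ENNReal.mul_rpow_of_nonneg _ _ hp0.le,
          ENNReal.ofReal_rpow_of_nonneg hk hp0.le, ofReal_rpow_rpow hx.1 _ hp0.le, mul_left_comm,
          ofReal_rpow_mul hx.1, ← hs]
        congr 3
        ring
    _ ≤ _ := by
        gcongr
        exact hΦ x hx

/-- On (0, c) the primitive of t^(γ+ε-1) is exactly x^(γ+ε)/(γ+ε), so the quotient of the two sides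
forces C ≤ (γ+ε)^p, and ε tends to 0. -/
lemma le_hardyConst_fromZero [Nontrivial H] (hp : 1 ≤ p) (hb : 0 < b) (hα : α < p - 1) {C : ℝ}
    (hC : ∀ F : ℝ → H →L[ℂ] H, IsAdmissible p α b F →
      (C : ℂ) * trace (weightedIntegral p (α - p) b (integralFromZero F)) ≤
        trace (weightedIntegral p α b F)) : C ≤ hardyConst p α := by
  have hp0 : 0 < p := by linarith
  rcases le_or_gt C 0 with hC0 | hC0
  · exact hC0.trans (hardyConst_pos hp hα.ne).le
  obtain ⟨c, hc0, hcb⟩ := EReal.lt_iff_exists_real_btwn.1 hb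
  have hc : 0 < c := by exact_mod_cast hc0
  set γ := (p - 1 - α) / p with hγdef
  have hγ : 0 < γ := div_pos (by linarith) hp0
  have hαγ : α = p - 1 - p * γ := by rw [hγdef]; field_simp; ring
  rw [hardyConst_eq hp, ← hγdef, abs_of_pos hγ]
  have key : ∀ ε : ℝ, 0 < ε → C ≤ (γ + ε) ^ p := by
    intro ε hε
    have hs : α + (γ + ε - 1) * p = ε * p - 1 := by rw [hαγ]; ring
    have hAeq := lintegral_cutPower hp hs hε hc hcb
    have hApos : 0 < c ^ (ε * p) / (ε * p) := by positivity
    have hA : ∫⁻ x in interval b, ENNReal.ofReal (x ^ α) * ‖cutPower c (γ + ε) x‖ₑ ^ p ≠ ∞ := by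
      rw [hAeq]; exact ENNReal.ofReal_ne_top
    have hmf := measurable_cutPower c (γ + ε)
    have hB := ne_top_of_ofReal_mul_le (hardyConst_pos hp hα.ne)
      (hardy_fromZero_le b hp hα hmf.enorm.aemeasurable).1 hA
    obtain ⟨hB', hle⟩ := scalar_le_of_operator_le (J := fun x => Ioo 0 x) hp
      ((measurableSet_lt measurable_const measurable_snd).inter
        (measurableSet_lt measurable_snd measurable_fst))
      (fun x hx t ht => ⟨ht.1, lt_trans (EReal.coe_lt_coe_iff.2 ht.2) hx.2⟩) hC hmf hA hB
    rw [hAeq] at hle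
    have h1 := mul_le_one_of_mul_toReal_le hC0.le hle (by simpa using hApos) ENNReal.ofReal_ne_top
      hB' (k := ((γ + ε)⁻¹) ^ p) (by positivity)
      (le_lintegral_of_forall_le hp hs hε hc hcb (by positivity) fun x hx => ?_)
    · rwa [Real.inv_rpow (by positivity), ← div_eq_mul_inv, div_le_one (by positivity)] at h1
    · have : ∫ t in Ioo 0 x, cutPower c (γ + ε) t = (γ + ε)⁻¹ * x ^ (γ + ε) := by
        rw [setIntegral_congr_fun measurableSet_Ioo (g := fun t => t ^ (γ + ε - 1)) fun t ht =>
          indicator_of_mem (show t ∈ Ioo 0 c from ⟨ht.1, ht.2.trans hx.2⟩) _,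
          ← integral_Ioc_eq_integral_Ioo, ← intervalIntegral.integral_of_le hx.1.le,
          integral_rpow (Or.inl (by linarith)), sub_add_cancel, Real.zero_rpow (by positivity)]
        ring
      rw [this, Real.enorm_of_nonneg (mul_nonneg (by positivity) (Real.rpow_nonneg hx.1.le _))]
  have hlim : Tendsto (fun ε : ℝ => (γ + ε) ^ p) (𝓝[>] 0) (𝓝 (γ ^ p)) := by
    have : ContinuousAt (fun ε : ℝ => (γ + ε) ^ p) 0 :=
      ContinuousAt.rpow_const (by fun_prop) (Or.inr hp0.le)
    simpa using this.tendsto.mono_left nhdsWithin_le_nhds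
  exact ge_of_tendsto hlim (eventually_mem_nhdsWithin.mono key)

lemma le_hardyConst_toEnd [Nontrivial H] (hp : 1 ≤ p) (hb : 0 < b) (hα : p - 1 < α) {C : ℝ}
    (hC : ∀ F : ℝ → H →L[ℂ] H, IsAdmissible p α b F →
      (C : ℂ) * trace (weightedIntegral p (α - p) b (integralToEnd b F)) ≤
        trace (weightedIntegral p α b F)) : C ≤ hardyConst p α := by
  have hp0 : 0 < p := by linarith
  rcases le_or_gt C 0 with hC0 | hC0
  · exact hC0.trans (hardyConst_pos hp hα.ne').le
  obtain ⟨c, hc0, hcb⟩ := EReal.lt_iff_exists_real_btwn.1 hb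
  have hc : 0 < c := by exact_mod_cast hc0
  set γ := (p - 1 - α) / p with hγdef
  have hγ : γ < 0 := div_neg_of_neg_of_pos (by linarith) hp0
  have hαγ : α = p - 1 - p * γ := by rw [hγdef]; field_simp; ring
  rw [hardyConst_eq hp, ← hγdef, abs_of_neg hγ]
  set δ := -γ with hδ
  have hδ0 : 0 < δ := neg_pos.2 hγ
  -- With η = δ - ε, integrating t^(-η-1) from x to c leaves the boundary term c^(-η). For x < θc it
  -- is at most θ^η x^(-η), whence the factor (1 - θ^η)/η; shrinking (0, c) to (0, θc) costs θ^(εp).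
  -- The limit ε → 0 is taken before θ → 0.
  have key : ∀ θ ε : ℝ, 0 < θ → θ < 1 → 0 < ε → ε < δ →
      C * (((1 - θ ^ (δ - ε)) / (δ - ε)) ^ p * θ ^ (ε * p)) ≤ 1 := by
    intro θ ε hθ hθ1 hε hεδ
    have hη : 0 < δ - ε := by linarith
    have hs : α + (-(δ - ε) - 1) * p = ε * p - 1 := by rw [hαγ, hδ]; ring
    have hAeq := lintegral_cutPower hp hs hε hc hcb
    have hApos : 0 < c ^ (ε * p) / (ε * p) := by positivity
    have hA : ∫⁻ x in interval b,
        ENNReal.ofReal (x ^ α) * ‖cutPower c (-(δ - ε)) x‖ₑ ^ p ≠ ∞ := by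
      rw [hAeq]; exact ENNReal.ofReal_ne_top
    have hmf := measurable_cutPower c (-(δ - ε))
    have hB := ne_top_of_ofReal_mul_le (hardyConst_pos hp hα.ne')
      (hardy_toEnd_le b hp hα hmf.enorm.aemeasurable).1 hA
    obtain ⟨hB', hle⟩ := scalar_le_of_operator_le
      (J := fun x => {t : ℝ | x < t ∧ (t : EReal) < b}) hp
      ((measurableSet_lt measurable_fst measurable_snd).inter
        (measurableSet_lt (measurable_coe_real_ereal.comp measurable_snd) measurable_const))
      (fun x hx t ht => ⟨hx.1.trans ht.1, ht.2⟩) hC hmf hA hB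
    rw [hAeq] at hle
    have hθη : θ ^ (δ - ε) < 1 := Real.rpow_lt_one hθ.le hθ1 hη
    have hk : 0 ≤ (1 - θ ^ (δ - ε)) / (δ - ε) := div_nonneg (by linarith) hη.le
    have hθc : θ * c < c := by nlinarith
    refine mul_le_one_of_mul_toReal_le hC0.le hle (by simpa using hApos) ENNReal.ofReal_ne_top
      hB' (by positivity) (le_trans (le_of_eq ?_) (le_lintegral_of_forall_le (c := θ * c) hp hs hε
        (by positivity) (lt_trans (EReal.coe_lt_coe_iff.2 hθc) hcb) hk fun x hx => ?_))
    · rw [ENNReal.ofReal_mul (by positivity), mul_assoc, ← ENNReal.ofReal_mul (by positivity),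
        Real.mul_rpow hθ.le hc.le, mul_div_assoc]
    · have hxc : x < c := hx.2.trans hθc
      have : ∫ t in {t : ℝ | x < t ∧ (t : EReal) < b}, cutPower c (-(δ - ε)) t =
          (x ^ (-(δ - ε)) - c ^ (-(δ - ε))) / (δ - ε) := by
        have h0 : (0 : ℝ) ∉ uIcc x c := by
          rw [uIcc_of_le hxc.le]
          exact fun h => not_lt.2 h.1 hx.1
        have hset : Ioo 0 c ∩ {t : ℝ | x < t ∧ (t : EReal) < b} = Ioo x c := by
          ext t
          exact ⟨fun h => ⟨h.2.1, h.1.2⟩, fun h => ⟨⟨hx.1.trans h.1, h.2⟩, h.1,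
            lt_trans (EReal.coe_lt_coe_iff.2 h.2) hcb⟩⟩
        rw [cutPower, integral_indicator measurableSet_Ioo,
          Measure.restrict_restrict measurableSet_Ioo, hset, ← integral_Ioc_eq_integral_Ioo,
          ← intervalIntegral.integral_of_le hxc.le,
          integral_rpow (Or.inr ⟨by linarith, h0⟩), sub_add_cancel, div_neg, ← neg_div, neg_sub]
      have hcx : c ^ (-(δ - ε)) ≤ θ ^ (δ - ε) * x ^ (-(δ - ε)) := by
        have h1 : x ^ (δ - ε) ≤ (θ * c) ^ (δ - ε) :=
          Real.rpow_le_rpow hx.1.le hx.2.le hη.le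
        have hxp : 0 < x ^ (δ - ε) := Real.rpow_pos_of_pos hx.1 _
        have hcp : 0 < c ^ (δ - ε) := Real.rpow_pos_of_pos hc _
        rw [Real.mul_rpow hθ.le hc.le] at h1
        rw [Real.rpow_neg hc.le, Real.rpow_neg hx.1.le, ← div_eq_mul_inv, le_div_iff₀ hxp,
          inv_mul_le_iff₀ hcp, mul_comm]
        exact h1
      rw [this]
      refine (ENNReal.ofReal_le_ofReal ?_).trans (Real.ofReal_le_enorm _)
      rw [div_mul_eq_mul_div]
      gcongr
      linarith
  have key2 : ∀ θ : ℝ, 0 < θ → θ < 1 → C * (1 - θ ^ δ) ^ p ≤ δ ^ p := by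
    intro θ hθ hθ1
    have hcont : ContinuousAt (fun ε : ℝ =>
        C * (((1 - θ ^ (δ - ε)) / (δ - ε)) ^ p * θ ^ (ε * p))) 0 := by
      have h1 : ContinuousAt (fun ε : ℝ => θ ^ (δ - ε)) 0 :=
        ContinuousAt.rpow continuousAt_const (by fun_prop) (Or.inl hθ.ne')
      have h2 : ContinuousAt (fun ε : ℝ => θ ^ (ε * p)) 0 :=
        ContinuousAt.rpow continuousAt_const (by fun_prop) (Or.inl hθ.ne')
      have h3 : ContinuousAt (fun ε : ℝ => (1 - θ ^ (δ - ε)) / (δ - ε)) 0 :=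
        (continuousAt_const.sub h1).div (by fun_prop) (by simpa using hδ0.ne')
      exact continuousAt_const.mul ((h3.rpow_const (Or.inr hp0.le)).mul h2)
    have hlim := hcont.tendsto.mono_left (nhdsWithin_le_nhds (s := Ioi 0))
    have h := le_of_tendsto hlim (b := 1) (by
      filter_upwards [Ioo_mem_nhdsGT hδ0] with ε hε
      exact key θ ε hθ hθ1 hε.1 hε.2)
    have hθη : θ ^ δ < 1 := Real.rpow_lt_one hθ.le hθ1 hδ0
    simp only [sub_zero, zero_mul, Real.rpow_zero, mul_one] at h
    rwa [Real.div_rpow (by linarith) hδ0.le, ← mul_div_assoc, div_le_one (by positivity)] at h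
  have hlim : Tendsto (fun θ : ℝ => C * (1 - θ ^ δ) ^ p) (𝓝[>] 0) (𝓝 C) := by
    have h1 : ContinuousAt (fun θ : ℝ => C * (1 - θ ^ δ) ^ p) 0 :=
      continuousAt_const.mul ((continuousAt_const.sub
        (continuousAt_id.rpow_const (Or.inr hδ0.le))).rpow_const (Or.inr hp0.le))
    have h2 := h1.tendsto.mono_left (nhdsWithin_le_nhds (s := Ioi 0))
    simpa [Real.zero_rpow hδ0.ne'] using h2
  refine le_of_tendsto hlim ?_
  filter_upwards [Ioo_mem_nhdsGT (zero_lt_one' ℝ)] with θ hθ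
  exact key2 θ hθ.1 hθ.2

end Sharpness

end OperatorHardy

open OperatorHardy in
theorem corollary4p1 {H : Type*} [NormedAddCommGroup H] [InnerProductSpace ℂ H] [CompleteSpace H]
    [TopologicalSpace.SeparableSpace H] (p : ℝ) (hp : 1 ≤ p) (b : EReal) (hb : 0 < b) (α : ℝ) :
    (α < p - 1 →
      (∀ F : ℝ → H →L[ℂ] H, IsAdmissible p α b F →
        -- all integrals converge and both sides are traces of trace class operators
        (∀ x ∈ interval b, IntegrableOn F (Ioo 0 x)) ∧
        IntegrableOn (weightedAbsPow p α F) (interval b) ∧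
        IntegrableOn (weightedAbsPow p (α - p) (integralFromZero F)) (interval b) ∧
        IsTraceClass (weightedIntegral p α b F) ∧
        IsTraceClass (weightedIntegral p (α - p) b (integralFromZero F)) ∧
        -- the inequality
        (hardyConst p α : ℂ) * trace (weightedIntegral p (α - p) b (integralFromZero F)) ≤
          trace (weightedIntegral p α b F) ∧
        -- the case of equality
        (1 < p ∨ b < ⊤ →
          (trace (weightedIntegral p α b F) =
              (hardyConst p α : ℂ) * trace (weightedIntegral p (α - p) b (integralFromZero F)) ↔
            ∀ᵐ x ∂(volume.restrict (interval b)), F x = 0))) ∧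
      -- the constant is best possible
      (Nontrivial H → ∀ C : ℝ,
        (∀ F : ℝ → H →L[ℂ] H, IsAdmissible p α b F →
          (C : ℂ) * trace (weightedIntegral p (α - p) b (integralFromZero F)) ≤
            trace (weightedIntegral p α b F)) →
        C ≤ hardyConst p α)) ∧
    (p - 1 < α →
      (∀ F : ℝ → H →L[ℂ] H, IsAdmissible p α b F →
        -- all integrals converge and both sides are traces of trace class operators
        (∀ x ∈ interval b, IntegrableOn F {t : ℝ | x < t ∧ (t : EReal) < b}) ∧
        IntegrableOn (weightedAbsPow p α F) (interval b) ∧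
        IntegrableOn (weightedAbsPow p (α - p) (integralToEnd b F)) (interval b) ∧
        IsTraceClass (weightedIntegral p α b F) ∧
        IsTraceClass (weightedIntegral p (α - p) b (integralToEnd b F)) ∧
        -- the inequality
        (hardyConst p α : ℂ) * trace (weightedIntegral p (α - p) b (integralToEnd b F)) ≤
          trace (weightedIntegral p α b F) ∧
        -- the case of equality
        (1 < p →
          (trace (weightedIntegral p α b F) =
              (hardyConst p α : ℂ) * trace (weightedIntegral p (α - p) b (integralToEnd b F)) ↔
            ∀ᵐ x ∂(volume.restrict (interval b)), F x = 0))) ∧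
      -- the constant is best possible
      (Nontrivial H → ∀ C : ℝ,
        (∀ F : ℝ → H →L[ℂ] H, IsAdmissible p α b F →
          (C : ℂ) * trace (weightedIntegral p (α - p) b (integralToEnd b F)) ≤
            trace (weightedIntegral p α b F)) →
        C ≤ hardyConst p α)) := by
  refine ⟨fun hα => ⟨fun F hF => operator_hardy_fromZero hp hα hF,
      fun _ C hC => le_hardyConst_fromZero hp hb hα hC⟩,
    fun hα => ⟨fun F hF => operator_hardy_toEnd hp hα hF,
      fun _ C hC => le_hardyConst_toEnd hp hb hα hC⟩⟩
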